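/- Let $(\mathcal A,h,D)$ be a spectral triple: $h$ is a complex Hilbert space, $\mathcal A\subseteq B(h)$ is a $*$-algebra of bounded operators (not necessarily unital), and $D$ is a densely defined self-adjoint operator on $h$ such that every $a\in\mathcal A$ maps $\mathrm{dom}(D)$ into itself and the commutator $[D,a]$, defined on $\mathrm{dom}(D)$, is bounded; $[D,a]$ also denotes its bounded extension to $h$. Assume that $(\mathcal A,h,D)$ is essentially discrete: the restriction of $D$ to $\ker(D)^\perp$ has discrete spectrum, i.e. $\sigma(D)\setminus\{0\}$ has no accumulation point in $\mathbb C$ (in particular not at $0$) and consists of eigenvalues of finite multiplicity; $\ker(D)$ may be infinite dimensional. Let $P_0$ be the orthogonal projection onto $\ker(D)$. Let $D^{-1}$, $|D|^{-1}$, $|D|^{-1/2}$ be given by the functional calculus of $D$ on $\ker(D)^\perp$ and vanish on $\ker(D)$. Put ${\bf ds}=D^{-1}$ and $$F=P_0+\frac{D}{\sqrt{1+D^2}},\qquad F_0=P_0+D|D|^{-1}.$$ For $T\in B(h)$ and $k\ge 0$ let $\mu_k(T)=\inf\{\|T-R\| : R\in B(h),\ \mathrm{rank}\,R\le k\}$ be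 the singular values of $T$. Let $0<\lambda_1(|D|)\le\lambda_2(|D|)\le\cdots$ be the nonzero eigenvalues of $|D|$, repeated according to multiplicity, with $\lambda_n(|D|)^{-1}=0$ if there are fewer than $n$ of them. Let $a=a^*\in\mathcal A$. Then for $G=F$ as well as for $G=F_0$: (i) there exist $\alpha,\beta,\gamma\in B(h)$ such that $$i[G,a]=\alpha|D|^{-1}+|D|^{-1}\beta+|D|^{-1/2}\gamma|D|^{-1/2},\qquad \|\alpha\|\le 2\|[D,a]\|,\quad \|\beta\|\le 2\|[D,a]\|,\quad \|\gamma\|\le\|[D,a]\|;$$ (ii) for all integers $k\ge 0$, $$\mu_{4k}(i[G,a])\le 5\,\|[D,a]\|\,\mu_k({\bf ds})=5\,\|[D,a]\|\,\mu_k(|D|^{-1})=5\,\|[D,a]\|\,\lambda_{k+1}(|D|)^{-1},$$ where moreover $\mu_k({\bf ds})=\mu_k(|D|^{-1})=\lambda_{k+1}(|D|)^{-1}$. -/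

import Mathlib

open scoped ENNReal NNReal

noncomputable section

namespace NCG

variable {H : Type*} [NormedAddCommGroup H] [InnerProductSpace ℂ H]

/-- The eigenspace `ker (T - z)` of a (possibly unbounded) operator `T` on `H`. -/
def eigenspace (T : H →ₗ.[ℂ] H) (z : ℂ) : Submodule ℂ H :=
  (LinearMap.ker (T.toFun - z • T.domain.subtype)).map T.domain.subtype

theorem mem_eigenspace_iff {T : H →ₗ.[ℂ] H} {z : ℂ} {x : H} :
    x ∈ eigenspace T z ↔ ∃ y : T.domain, T y = z • (y : H) ∧ (y : H) = x := by
  simp [eigenspace, sub_eq_zero]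

/-- `z` belongs to the resolvent set of `T`: the operator `T - z : dom T → H` has a bounded
everywhere defined inverse `R`. -/
def InResolventSet (T : H →ₗ.[ℂ] H) (z : ℂ) : Prop :=
  ∃ R : H →L[ℂ] H,
    (∀ y : H, ∃ x : T.domain, (x : H) = R y ∧ T x - z • (x : H) = y) ∧
      ∀ x : T.domain, R (T x - z • (x : H)) = x

/-- The spectrum `σ(T)`. -/
def opSpectrum (T : H →ₗ.[ℂ] H) : Set ℂ := {z | ¬ InResolventSet T z}

/-- `T` has discrete spectrum away from its kernel: `σ(T) \ {0}` is a closed discrete subset of the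
plane (it has finitely many points in each disc, so that it does not accumulate at `0` either),
and its points have finite multiplicity. The kernel of `T` may be infinite dimensional. -/
def IsEssentiallyDiscreteOp (T : H →ₗ.[ℂ] H) : Prop :=
  (∀ r : ℝ, {z ∈ opSpectrum T \ {0} | ‖z‖ ≤ r}.Finite) ∧
    ∀ z ∈ opSpectrum T \ {0}, FiniteDimensional ℂ (eigenspace T z)

/-- If `T` is essentially discrete, then every function that is bounded by `1` outside `[-1, 1]`
(such as `|s|⁻¹`) is bounded on the eigenvalues of `T`. -/
theorem IsEssentiallyDiscreteOp.exists_bound {T : H →ₗ.[ℂ] H} (hT : IsEssentiallyDiscreteOp T)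
    {f : ℝ → ℝ} (hf : ∀ s, 1 < |s| → |f s| ≤ 1) :
    ∃ C : ℝ, ∀ s : ℝ, eigenspace T (s : ℂ) ≠ ⊥ → |f s| ≤ C := by
  have hfin : {s : ℝ | s = 0 ∨ (s : ℂ) ∈ {z ∈ opSpectrum T \ {0} | ‖z‖ ≤ 1}}.Finite :=
    (Set.finite_singleton 0).union ((hT.1 1).preimage Complex.ofReal_injective.injOn)
  obtain ⟨C, hC⟩ := (hfin.image fun s => |f s|).bddAbove
  refine ⟨max 1 C, fun s hs => ?_⟩
  rcases lt_or_ge 1 |s| with h | h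
  · exact (hf s h).trans (le_max_left _ _)
  · refine (hC ⟨s, ?_, rfl⟩).trans (le_max_right _ _)
    by_cases h0 : s = 0
    · exact Or.inl h0
    · refine Or.inr ⟨⟨?_, by simpa using h0⟩, by simpa using h⟩
      rintro ⟨R, -, hR⟩
      obtain ⟨x, hx, hx0⟩ := (Submodule.ne_bot_iff _).1 hs
      obtain ⟨y, hy, rfl⟩ := mem_eigenspace_iff.1 hx
      apply hx0
      rw [← hR y, hy, sub_self, map_zero]

variable [CompleteSpace H]

/-- The orthogonal projection onto `ker (T - z)`. (Eigenspaces of a closed operator are closed,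
so that the closure changes nothing for such operators.) -/
def eigenProj (T : H →ₗ.[ℂ] H) (z : ℂ) : H →L[ℂ] H :=
  (eigenspace T z).topologicalClosure.starProjection

open Classical in
/-- Functional calculus of a diagonalizable self-adjoint operator: the bounded operator
`f(T) = ∑ f(s) P_s` (strongly convergent sum), where `s` runs over the reals and `P_s` is the
projection onto `ker (T - s)`. It exists as soon as `f` is bounded on the eigenvalues of `T`, see
`funCalc_hasSum` and `IsEssentiallyDiscreteOp.exists_bound`; otherwise the value is `0`. -/
def funCalc (T : H →ₗ.[ℂ] H) (f : ℝ → ℝ) : H →L[ℂ] H :=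
  if h : ∃ B : H →L[ℂ] H, ∀ x, HasSum (fun s : ℝ => (f s : ℂ) • eigenProj T (s : ℂ) x) (B x)
  then h.choose else 0

theorem eigenspace_isOrtho {T : H →ₗ.[ℂ] H} (hT : IsSelfAdjoint T) {s t : ℝ} (hst : s ≠ t) :
    eigenspace T (s : ℂ) ⟂ eigenspace T (t : ℂ) := by
  rw [Submodule.isOrtho_iff_inner_eq]
  intro u hu v hv
  obtain ⟨x, hx, rfl⟩ := mem_eigenspace_iff.1 hu
  obtain ⟨y, hy, rfl⟩ := mem_eigenspace_iff.1 hv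
  have h := LinearPMap.adjoint_isFormalAdjoint hT.dense_domain
  rw [LinearPMap.isSelfAdjoint_def.1 hT] at h
  have h1 := h x y
  rw [hx, hy, inner_smul_left, inner_smul_right, Complex.conj_ofReal] at h1
  have h2 : ((s : ℂ) - t) * inner ℂ (x : H) (y : H) = 0 := by rw [sub_mul, h1, sub_self]
  rcases mul_eq_zero.1 h2 with h3 | h3
  · exact absurd (by exact_mod_cast sub_eq_zero.1 h3) hst
  · exact h3

/-- The functional calculus exists for every self-adjoint operator and every function that is
bounded on its eigenvalues. -/
theorem funCalc_hasSum {T : H →ₗ.[ℂ] H} (hT : IsSelfAdjoint T) {f : ℝ → ℝ} {C : ℝ}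
    (hf : ∀ s : ℝ, eigenspace T (s : ℂ) ≠ ⊥ → |f s| ≤ C) (x : H) :
    HasSum (fun s : ℝ => (f s : ℂ) • eigenProj T (s : ℂ) x) (funCalc T f x) := by
  classical
  set V : ℝ → Submodule ℂ H := fun s => (eigenspace T (s : ℂ)).topologicalClosure with hV
  have hort : OrthogonalFamily ℂ (fun s => V s) fun s => (V s).subtypeₗᵢ := by
    refine OrthogonalFamily.of_pairwise fun s t hst => ?_
    have h := eigenspace_isOrtho hT hst
    change V s ⟂ V t
    rw [Submodule.isOrtho_iff_le] at h ⊢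
    simp only [hV]
    rw [Submodule.orthogonal_closure]
    exact Submodule.topologicalClosure_minimal _ h (Submodule.isClosed_orthogonal _)
  have hmem : ∀ (s : ℝ) (y : H), eigenProj T (s : ℂ) y ∈ V s := fun s y =>
    Submodule.starProjection_apply_mem _ y
  have hself : ∀ (s : ℝ) (y : H),
      inner ℂ y (eigenProj T (s : ℂ) y) = ((‖eigenProj T (s : ℂ) y‖ ^ 2 : ℝ) : ℂ) := by
    intro s y
    have h := Submodule.starProjection_inner_eq_zero (K := V s) y _ (hmem s y)
    rw [inner_sub_left, sub_eq_zero] at h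
    rw [h]
    exact_mod_cast inner_self_eq_norm_sq_to_K (𝕜 := ℂ) (eigenProj T (s : ℂ) y)
  have hbessel : ∀ (y : H) (u : Finset ℝ), ∑ s ∈ u, ‖eigenProj T (s : ℂ) y‖ ^ 2 ≤ ‖y‖ ^ 2 := by
    intro y u
    have h1 := hort.norm_sum (fun s => ⟨eigenProj T (s : ℂ) y, hmem s y⟩) u
    simp only [Submodule.coe_subtypeₗᵢ, Submodule.subtype_apply] at h1
    set p := ∑ s ∈ u, eigenProj T (s : ℂ) y with hp
    have h2 : inner ℂ y p = ((‖p‖ ^ 2 : ℝ) : ℂ) := by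
      rw [h1, hp, inner_sum, Complex.ofReal_sum]
      exact Finset.sum_congr rfl fun s _ => hself s y
    have h3 : ‖p‖ ^ 2 ≤ ‖y‖ * ‖p‖ := by
      have := norm_inner_le_norm (𝕜 := ℂ) y p
      rwa [h2, Complex.norm_real, Real.norm_eq_abs, abs_of_nonneg (by positivity)] at this
    have h4 : ‖p‖ ≤ ‖y‖ := by
      rcases (norm_nonneg p).eq_or_lt with h | h
      · rw [← h]; positivity
      · exact le_of_mul_le_mul_right (by nlinarith) h
    calc _ = ‖p‖ ^ 2 := h1.symm
      _ ≤ ‖y‖ ^ 2 := by gcongr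
  have hterm : ∀ (s : ℝ) (y : H), ‖(f s : ℂ) • eigenProj T (s : ℂ) y‖ ^ 2 ≤
      |C| ^ 2 * ‖eigenProj T (s : ℂ) y‖ ^ 2 := by
    intro s y
    by_cases h : eigenspace T (s : ℂ) = ⊥
    · have h0 : eigenProj T (s : ℂ) y = 0 := by
        have hm := hmem s y
        have hb : V s = ⊥ := by
          simp only [hV, h]
          exact (isClosed_singleton (x := (0 : H))).submodule_topologicalClosure_eq
        rwa [hb, Submodule.mem_bot] at hm
      simp [h0]
    · rw [norm_smul, mul_pow, Complex.norm_real, Real.norm_eq_abs]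
      have := (hf s h).trans (le_abs_self C)
      gcongr
  have hmem' : ∀ (s : ℝ) (y : H), (f s : ℂ) • eigenProj T (s : ℂ) y ∈ V s := fun s y =>
    Submodule.smul_mem _ _ (hmem s y)
  have hsum : ∀ y : H, Summable fun s : ℝ => (f s : ℂ) • eigenProj T (s : ℂ) y := by
    intro y
    refine (hort.summable_iff_norm_sq_summable
      (fun s => ⟨(f s : ℂ) • eigenProj T (s : ℂ) y, hmem' s y⟩)).2 ?_
    have h1 : Summable fun s : ℝ => ‖eigenProj T (s : ℂ) y‖ ^ 2 :=
      summable_of_sum_le (fun s => by positivity) (hbessel y)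
    exact Summable.of_nonneg_of_le (fun s => by positivity) (fun s => hterm s y)
      (h1.mul_left (|C| ^ 2))
  have hbound : ∀ y : H, ‖∑' s : ℝ, (f s : ℂ) • eigenProj T (s : ℂ) y‖ ≤ |C| * ‖y‖ := by
    intro y
    refine le_of_tendsto (hsum y).hasSum.norm (Filter.Eventually.of_forall fun u => ?_)
    refine le_of_sq_le_sq ?_ (by positivity)
    have h1 := hort.norm_sum (fun s => ⟨(f s : ℂ) • eigenProj T (s : ℂ) y, hmem' s y⟩) u
    simp only [Submodule.coe_subtypeₗᵢ, Submodule.subtype_apply] at h1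
    rw [h1, mul_pow]
    calc _ ≤ ∑ s ∈ u, |C| ^ 2 * ‖eigenProj T (s : ℂ) y‖ ^ 2 :=
          Finset.sum_le_sum fun s _ => hterm s y
      _ ≤ _ := by
          rw [← Finset.mul_sum]
          exact mul_le_mul_of_nonneg_left (hbessel y u) (by positivity)
  have hex : ∃ B : H →L[ℂ] H,
      ∀ x, HasSum (fun s : ℝ => (f s : ℂ) • eigenProj T (s : ℂ) x) (B x) := by
    refine ⟨LinearMap.mkContinuous
      { toFun := fun y => ∑' s : ℝ, (f s : ℂ) • eigenProj T (s : ℂ) y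
        map_add' := fun y z => ?_
        map_smul' := fun c y => ?_ } |C| hbound, fun y => (hsum y).hasSum⟩
    · simp only [map_add, smul_add]
      exact (hsum y).tsum_add (hsum z)
    · simp only [map_smul, RingHom.id_apply]
      rw [← (hsum y).tsum_const_smul c]
      exact tsum_congr fun s => smul_comm _ _ _
  rw [funCalc, dif_pos hex]
  exact hex.choose_spec x

/-- The distance from `T` to the operators of rank at most `k`: the `k`-th singular value
(characteristic value) `μ_k(T)`, `k = 0, 1, 2, …`. -/
def singularValue (k : ℕ) (T : H →L[ℂ] H) : ℝ :=
  sInf {r : ℝ | ∃ R : H →L[ℂ] H, LinearMap.rank (R : H →ₗ[ℂ] H) ≤ k ∧ r = ‖T - R‖}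

/-- The `n`-th element `λ_n(T)`, `n = 1, 2, …`, of the increasing enumeration, with multiplicities,
of the positive eigenvalues of `T`: the least `t > 0` such that the eigenspaces of `T` for
eigenvalues in `(0, t]` span a space of dimension at least `n`; it is `∞` if there are fewer than
`n` positive eigenvalues. -/
def posEigenvalue (T : H →ₗ.[ℂ] H) (n : ℕ) : ℝ≥0∞ :=
  ⨅ (t : ℝ≥0) (_ : 0 < t ∧ (n : Cardinal) ≤
    Module.rank ℂ ↥(⨆ s ∈ Set.Ioc (0 : ℝ) t, eigenspace T (s : ℂ))), (t : ℝ≥0∞)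

variable (H) in
/-- A spectral triple `(𝒜, H, D)`: a `*`-algebra `𝒜` of bounded operators on `H` and a (densely
defined) self-adjoint operator `D` such that `[D, a]` is bounded for every `a ∈ 𝒜`, that is, `a`
maps `dom D` to itself and `D a - a D` is bounded on `dom D`. -/
structure SpectralTriple where
  A : NonUnitalStarSubalgebra ℂ (H →L[ℂ] H)
  D : H →ₗ.[ℂ] H
  selfAdjoint : IsSelfAdjoint D
  map_domain : ∀ a ∈ A, ∀ x ∈ D.domain, a x ∈ D.domain
  bounded_commutator : ∀ a, ∀ ha : a ∈ A, ∃ C : ℝ, ∀ x : D.domain,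
    ‖D ⟨a x, map_domain a ha x x.2⟩ - a (D x)‖ ≤ C * ‖(x : H)‖

namespace SpectralTriple

variable (S : SpectralTriple H)

/-- The commutator `[D, a] = D a - a D` on `dom D`. -/
def commutatorOnDomain (a : S.A) : S.D.domain →ₗ[ℂ] H where
  toFun x := S.D ⟨(a : H →L[ℂ] H) x, S.map_domain a a.2 x x.2⟩ - (a : H →L[ℂ] H) (S.D x)
  map_add' x y := by
    have h : (⟨(a : H →L[ℂ] H) ((x + y : S.D.domain) : H), S.map_domain a a.2 _ (x + y).2⟩ :
        S.D.domain) = ⟨(a : H →L[ℂ] H) x, S.map_domain a a.2 x x.2⟩ +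
          ⟨(a : H →L[ℂ] H) y, S.map_domain a a.2 y y.2⟩ := by
      ext; simp
    rw [h, LinearPMap.map_add, LinearPMap.map_add, map_add]
    abel
  map_smul' c x := by
    have h : (⟨(a : H →L[ℂ] H) ((c • x : S.D.domain) : H), S.map_domain a a.2 _ (c • x).2⟩ :
        S.D.domain) = c • ⟨(a : H →L[ℂ] H) x, S.map_domain a a.2 x x.2⟩ := by
      ext; simp
    rw [h, LinearPMap.map_smul, LinearPMap.map_smul, map_smul, RingHom.id_apply, smul_sub]

/-- The bounded operator `[D, a]` on `H`, the continuous extension of the commutator. -/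
def commutator (a : S.A) : H →L[ℂ] H :=
  (S.commutatorOnDomain a).extendOfNorm S.D.domain.subtype

theorem commutator_apply (a : S.A) (x : S.D.domain) :
    S.commutator a x = S.commutatorOnDomain a x :=
  LinearMap.extendOfNorm_eq
    (by simpa [DenseRange] using S.selfAdjoint.dense_domain) (S.bounded_commutator a a.2) x

/-- `(𝒜, H, D)` is essentially discrete. -/
def IsEssentiallyDiscrete : Prop := IsEssentiallyDiscreteOp S.D

/-- The orthogonal projection `P₀` onto `ker D`. -/
def P₀ : H →L[ℂ] H := eigenProj S.D 0

/-- The line element `ds = D⁻¹`, which vanishes on `ker D`. -/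
def invD : H →L[ℂ] H := funCalc S.D fun x => x⁻¹

/-- `|D|⁻¹`, which vanishes on `ker D`. -/
def invAbsD : H →L[ℂ] H := funCalc S.D fun x => |x|⁻¹

/-- `|D|^{-1/2}`, which vanishes on `ker D`. -/
def invSqrtAbsD : H →L[ℂ] H := funCalc S.D fun x => √(|x|⁻¹)

/-- `sign(D) = D |D|⁻¹`, which vanishes on `ker D`. -/
def signD : H →L[ℂ] H := funCalc S.D Real.sign

/-- `|D| = sign(D) D`, with the domain of `D`. -/
def absD : H →ₗ.[ℂ] H := (S.signD : H →ₗ[ℂ] H).compPMap S.D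

/-- `F = P₀ + D (1 + D²)^{-1/2}`. -/
def F : H →L[ℂ] H := S.P₀ + funCalc S.D fun x => x / √(1 + x ^ 2)

/-- `F₀ = P₀ + D |D|⁻¹`. -/
def F₀ : H →L[ℂ] H := S.P₀ + S.signD

end SpectralTriple

/-- The quantum differential `i [G, a]` of `a` with respect to `G`. -/
def quantumDiff (G a : H →L[ℂ] H) : H →L[ℂ] H := Complex.I • (G * a - a * G)

end NCG

end

open scoped ENNReal NNReal

noncomputable section

/-! ### Resolvents and totality of the eigenvectors -/

namespace NCG

variable {H : Type*} [NormedAddCommGroup H] [InnerProductSpace ℂ H]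

/-! Discreteness of the spectrum away from 0 provides a real point of the resolvent set. The
resolvent there is a bounded self-adjoint injective operator whose nonzero spectrum is discrete, so
its eigenvectors, which are eigenvectors of D, are total (`eq_zero_of_forall_inner_eigenspace`).
Hence every bounded operator is determined by its blocks between eigenspaces of D. The commutator X
= [D, a] has blocks X_ts = (t - s) a_ts, and i[G, a] has blocks i(g(t) - g(s)) a_ts, where g is
`phaseFun ε`; ε = 1 gives F and ε = 0 gives F₀.

Blocks with exactly one of s, t equal to 0 can be divided by the nonzero difference t - s, which
yields the terms with α and β; the block at (0, 0) vanishes. For s, t ≠ 0 one uses π s / √(ε + s²) =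
∫ s / (r² + ε + s²) dr. With c² = r² + ε and d_s = (c² + s²)⁻¹, t d_t - s d_s = (c d_t)(t - s)(c
d_s) - (t d_t)(t - s)(s d_s), so the integrand is a difference of two compressions of X. By
Cauchy-Schwarz and (c² + s²) d_s² = d_s, its form is bounded by ‖X‖/2 times a sum weighted by d_s,
whose integral is at most π / |s|. This bounds the form of the compressed commutator by ‖X‖
‖|D|^{-1/2} y‖ ‖|D|^{-1/2} x‖, and a factorization produces γ (`norm_sum_integrand_le`,
`exists_eq_mul_mul_of_inner_le`, `exists_quantumDiff_eq`).

For the singular values, let Q be the spectral projection of D for 0 < |s| ≤ t with t < λ_{k+1}. It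
has rank at most k. Cutting the three terms with Q costs four operators of rank at most k and leaves
an error of at most (2 + 2 + 1) ‖X‖ / t (`singularValue_four_mul_le`). Then t tends to λ_{k+1}. -/

/-- `R` is the resolvent `(T - z)⁻¹`. -/
def IsResolvent (T : H →ₗ.[ℂ] H) (z : ℂ) (R : H →L[ℂ] H) : Prop :=
  (∀ y : H, ∃ x : T.domain, (x : H) = R y ∧ T x - z • (x : H) = y) ∧
    ∀ x : T.domain, R (T x - z • (x : H)) = x

theorem IsResolvent.eq_add {T : H →ₗ.[ℂ] H} {z w : ℂ} {R R' : H →L[ℂ] H}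
    (hR : IsResolvent T z R) (hR' : IsResolvent T w R') (y : H) :
    R' y = R y + (w - z) • R (R' y) := by
  obtain ⟨x, hx, hxy⟩ := hR'.1 y
  have h := hR.2 x
  have h1 : T x - z • (x : H) = y + (w - z) • (x : H) := by
    rw [← hxy, sub_smul]; abel
  rw [h1, map_add, map_smul, hx] at h
  exact h.symm

/-- Only finitely many nonzero spectral points lie in the unit disc, so some point of the interval
(0, 1) is regular. Its being real is what makes the resolvent self-adjoint. -/
theorem IsEssentiallyDiscreteOp.exists_resolvent {T : H →ₗ.[ℂ] H}
    (hT : IsEssentiallyDiscreteOp T) : ∃ (r : ℝ) (R : H →L[ℂ] H), IsResolvent T r R := by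
  have hfin : {s : ℝ | (s : ℂ) ∈ {z ∈ opSpectrum T \ {0} | ‖z‖ ≤ 1}}.Finite :=
    (hT.1 1).preimage Complex.ofReal_injective.injOn
  obtain ⟨r, hr, hr'⟩ := ((Set.Ioo_infinite (zero_lt_one' ℝ)).sdiff hfin).nonempty
  have h : ¬ ((r : ℂ) ∈ opSpectrum T) := fun h => hr' ⟨⟨h, by simpa using hr.1.ne'⟩, by
    simpa [abs_of_pos hr.1] using hr.2.le⟩
  obtain ⟨R, hR⟩ := not_not.1 h
  exact ⟨r, R, hR⟩

/-- If R' were the resolvent at r + μ⁻¹, the resolvent identity would make μ⁻¹(1 + μ⁻¹ R') an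
inverse of μ - R. -/
theorem IsResolvent.mem_opSpectrum {T : H →ₗ.[ℂ] H} {r : ℝ} {R : H →L[ℂ] H}
    (hR : IsResolvent T r R) {μ : ℝ} (hμ : μ ≠ 0) (h : μ ∈ spectrum ℝ R) :
    ((r + μ⁻¹ : ℝ) : ℂ) ∈ opSpectrum T := by
  rintro ⟨R', hR'⟩
  refine h ?_
  rw [spectrum.mem_resolventSet_iff]
  change IsResolvent T _ R' at hR'
  have hc : (μ : ℂ) ≠ 0 := by exact_mod_cast hμ
  have h1 := fun y => hR.eq_add hR' y
  have h2 := fun y => hR'.eq_add hR y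
  have e : (((r + μ⁻¹ : ℝ) : ℂ) - r) = (μ : ℂ)⁻¹ := by push_cast; ring
  have e' : ((r : ℂ) - ((r + μ⁻¹ : ℝ) : ℂ)) = -(μ : ℂ)⁻¹ := by push_cast; ring
  simp only [e] at h1
  simp only [e'] at h2
  have ha : algebraMap ℝ (H →L[ℂ] H) μ = (μ : ℂ) • (1 : H →L[ℂ] H) := by
    ext x; simp [Algebra.algebraMap_eq_smul_one]
  rw [ha]
  refine ⟨⟨(μ : ℂ) • 1 - R, (μ : ℂ)⁻¹ • (1 + (μ : ℂ)⁻¹ • R'), ?_, ?_⟩, rfl⟩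
  · ext y
    change (μ : ℂ) • ((μ : ℂ)⁻¹ • (y + (μ : ℂ)⁻¹ • R' y)) -
      R ((μ : ℂ)⁻¹ • (y + (μ : ℂ)⁻¹ • R' y)) = y
    rw [map_smul, map_add, map_smul, ← h1 y, smul_inv_smul₀ hc]
    abel
  · ext y
    change (μ : ℂ)⁻¹ • (((μ : ℂ) • y - R y) + (μ : ℂ)⁻¹ • R' ((μ : ℂ) • y - R y)) = y
    rw [map_sub, map_smul, smul_sub, inv_smul_smul₀ hc]
    nth_rewrite 1 [h2 y]
    rw [neg_smul, show (μ : ℂ) • y - (R' y + -((μ : ℂ)⁻¹ • R' (R y))) +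
      (R' y - (μ : ℂ)⁻¹ • R' (R y)) = (μ : ℂ) • y by abel, inv_smul_smul₀ hc]

variable [CompleteSpace H]

theorem inner_map_eq {T : H →ₗ.[ℂ] H} (hT : IsSelfAdjoint T) (x y : T.domain) :
    inner ℂ (T x) (y : H) = inner ℂ (x : H) (T y) := by
  have h := LinearPMap.adjoint_isFormalAdjoint hT.dense_domain
  rw [LinearPMap.isSelfAdjoint_def.1 hT] at h
  exact h x y

/-- T is closed, being an adjoint, and its eigenspace is the preimage of its graph under x ↦ (x, z
x). -/
theorem isClosed_eigenspace {T : H →ₗ.[ℂ] H} (hT : IsSelfAdjoint T) (z : ℂ) :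
    IsClosed (eigenspace T z : Set H) := by
  have h : T.IsClosed := by
    have := LinearPMap.adjoint_isClosed hT.dense_domain
    rwa [LinearPMap.isSelfAdjoint_def.1 hT] at this
  have h1 : (eigenspace T z : Set H) = (fun x : H => (x, z • x)) ⁻¹' (T.graph : Set (H × H)) := by
    ext x
    simp only [SetLike.mem_coe, mem_eigenspace_iff, Set.mem_preimage, LinearPMap.mem_graph_iff]
    constructor
    · rintro ⟨y, hy, rfl⟩
      exact ⟨y, rfl, hy⟩
    · rintro ⟨y, rfl, hy⟩
      exact ⟨y, hy, rfl⟩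
  rw [h1]
  exact h.preimage (by fun_prop)

theorem IsResolvent.isSelfAdjoint {T : H →ₗ.[ℂ] H} (hT : IsSelfAdjoint T) {r : ℝ}
    {R : H →L[ℂ] H} (hR : IsResolvent T r R) : IsSelfAdjoint R := by
  rw [ContinuousLinearMap.isSelfAdjoint_iff_isSymmetric]
  intro u v
  obtain ⟨x, hx, hxu⟩ := hR.1 u
  obtain ⟨y, hy, hyv⟩ := hR.1 v
  change inner ℂ (R u) v = inner ℂ u (R v)
  rw [← hx, ← hy, ← hxu, ← hyv, inner_sub_left, inner_sub_right, inner_map_eq hT,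
    inner_smul_left, inner_smul_right, Complex.conj_ofReal]

/-- Nonzero points of s are isolated, since only finitely many points of s have modulus at least |μ|
/ 2. This makes point indicators admissible in the continuous functional calculus. -/
theorem continuousOn_single_of_isolated {s : Set ℝ} {μ : ℝ} (hμ : μ ≠ 0)
    (hs : ∀ ε > 0, {t ∈ s | ε ≤ |t|}.Finite) :
    ContinuousOn (fun t : ℝ => if t = μ then (1 : ℝ) else 0) s := by
  intro t ht
  by_cases h : t = μ
  · subst h
    have hf := hs (|t| / 2) (by positivity)
    have h1 : ∀ᶠ x in nhds t, |t| / 2 < |x| :=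
      continuous_abs.continuousAt.eventually_const_lt (half_lt_self (abs_pos.2 hμ))
    have h2 : ∀ᶠ x in nhds t, x ∉ {x ∈ s | |t| / 2 ≤ |x|} \ {t} :=
      (hf.subset Set.sdiff_subset).isClosed.isOpen_compl.mem_nhds (by simp)
    refine ContinuousWithinAt.congr_of_eventuallyEq (f := fun _ => (1 : ℝ))
      continuousWithinAt_const ?_ (by simp)
    filter_upwards [nhdsWithin_le_nhds h1, nhdsWithin_le_nhds h2, self_mem_nhdsWithin]
      with x hx1 hx2 hx3
    rw [if_pos]
    by_contra h
    exact hx2 ⟨⟨hx3, hx1.le⟩, h⟩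
  · refine (ContinuousAt.congr (f := fun _ => (0 : ℝ)) continuousAt_const ?_).continuousWithinAt
    filter_upwards [isOpen_ne.mem_nhds h] with x hx
    rw [if_neg hx]

/-- A self-adjoint operator whose nonzero spectrum is discrete is diagonalizable. -/
theorem apply_eq_zero_of_forall_inner_eq_zero {R : H →L[ℂ] H} (hR : IsSelfAdjoint R)
    (hfin : ∀ ε > 0, {t ∈ spectrum ℝ R | ε ≤ |t|}.Finite) {x : H}
    (hx : ∀ μ : ℝ, μ ≠ 0 → ∀ v, R v = (μ : ℂ) • v → inner ℂ v x = 0) : R x = 0 := by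
  classical
  have key : ∀ ε > 0, ‖R x‖ ≤ ε * ‖x‖ := by
    intro ε hε
    set K := (hfin ε hε).toFinset with hK
    have hKm : ∀ μ, μ ∈ K ↔ μ ∈ spectrum ℝ R ∧ ε ≤ |μ| := by simp [hK]
    have hne : ∀ μ ∈ K, μ ≠ 0 := by
      rintro μ hμ rfl
      have := ((hKm _).1 hμ).2
      rw [abs_zero] at this
      exact absurd this (not_le.2 hε)
    let δ : ℝ → ℝ → ℝ := fun μ t => if t = μ then (1 : ℝ) else 0
    have hδ : ∀ μ ∈ K, ContinuousOn (δ μ) (spectrum ℝ R) := fun μ hμ =>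
      continuousOn_single_of_isolated (hne μ hμ) hfin
    have hzero : ∀ μ ∈ K, cfc (δ μ) R x = 0 := by
      intro μ hμ
      have hc := hδ μ hμ
      -- The range of δ_μ(R) lies in the μ-eigenspace of R, and δ_μ(R) is self-adjoint; so it kills
      -- every x orthogonal to the eigenvectors.
      have h1 : R * cfc (δ μ) R = μ • cfc (δ μ) R := by
        have h0 := cfc_mul (fun t : ℝ => t) (δ μ) R continuousOn_id hc
        rw [cfc_id' ℝ R] at h0
        rw [← h0, ← cfc_const_mul μ (δ μ) R hc]
        congr 1
        ext t
        by_cases h : t = μ <;> simp [δ, h]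
      have hsa : IsSelfAdjoint (cfc (δ μ) R) := cfc_predicate _ R
      rw [ContinuousLinearMap.isSelfAdjoint_iff_isSymmetric] at hsa
      refine ext_inner_left ℂ fun v => ?_
      have h2 := hsa v x
      simp only [ContinuousLinearMap.coe_coe] at h2
      rw [inner_zero_right, ← h2]
      refine hx μ (hne μ hμ) _ ?_
      have := congrArg (fun B : H →L[ℂ] H => B v) h1
      simpa using this
    have hcf : ContinuousOn (fun t => ∑ μ ∈ K, μ * δ μ t) (spectrum ℝ R) :=
      continuousOn_finsetSum _ fun μ hμ => continuousOn_const.mul (hδ μ hμ)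
    have hsum : cfc (fun t => ∑ μ ∈ K, μ * δ μ t) R x = 0 := by
      have : cfc (∑ μ ∈ K, fun t => μ * δ μ t) R = ∑ μ ∈ K, cfc (fun t => μ * δ μ t) R :=
        cfc_sum (fun μ t => μ * δ μ t) R K fun μ hμ => continuousOn_const.mul (hδ μ hμ)
      have e : (fun t => ∑ μ ∈ K, μ * δ μ t) = ∑ μ ∈ K, fun t => μ * δ μ t := by
        ext t; simp
      rw [e, this, sum_apply]
      refine Finset.sum_eq_zero fun μ hμ => ?_
      rw [cfc_const_mul μ (δ μ) R (hδ μ hμ), smul_apply, hzero μ hμ, smul_zero]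
    -- On the spectrum the sum equals t where |t| ≥ ε and 0 elsewhere, so it differs from the
    -- identity function by at most ε.
    have hnorm : ‖R - cfc (fun t => ∑ μ ∈ K, μ * δ μ t) R‖ ≤ ε := by
      have h1 : R - cfc (fun t => ∑ μ ∈ K, μ * δ μ t) R =
          cfc (fun t => t - ∑ μ ∈ K, μ * δ μ t) R := by
        rw [cfc_sub (fun t : ℝ => t) _ R continuousOn_id hcf, cfc_id' ℝ R]
      rw [h1]
      refine norm_cfc_le hε.le fun t ht => ?_
      have h2 : ∑ μ ∈ K, μ * δ μ t = if t ∈ K then t else 0 := by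
        simp [δ, Finset.sum_ite_eq]
      rw [h2]
      split_ifs with h
      · simpa using hε.le
      · rw [sub_zero, Real.norm_eq_abs]
        by_contra h'
        exact h ((hKm t).2 ⟨ht, (not_le.1 h').le⟩)
    calc ‖R x‖ = ‖(R - cfc (fun t => ∑ μ ∈ K, μ * δ μ t) R) x‖ := by
          rw [sub_apply, hsum, sub_zero]
      _ ≤ ε * ‖x‖ := ContinuousLinearMap.le_of_opNorm_le _ hnorm x
  rw [← norm_le_zero_iff]
  refine ge_of_tendsto (x := nhdsWithin (0 : ℝ) (Set.Ioi 0)) (f := fun ε => ε * ‖x‖) ?_ ?_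
  · have : Filter.Tendsto (fun ε : ℝ => ε * ‖x‖) (nhds 0) (nhds (0 * ‖x‖)) :=
      Filter.tendsto_id.mul_const _
    rw [zero_mul] at this
    exact this.mono_left nhdsWithin_le_nhds
  · filter_upwards [self_mem_nhdsWithin] with ε hε using key ε hε

/-- The eigenvectors of an essentially discrete self-adjoint operator are total. -/
theorem eq_zero_of_forall_inner_eigenspace {T : H →ₗ.[ℂ] H} (hT : IsSelfAdjoint T)
    (hd : IsEssentiallyDiscreteOp T) {x : H}
    (hx : ∀ s : ℝ, ∀ v ∈ eigenspace T (s : ℂ), inner ℂ v x = 0) : x = 0 := by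
  obtain ⟨r, R, hR⟩ := hd.exists_resolvent
  have hRx : R x = 0 := by
    refine apply_eq_zero_of_forall_inner_eq_zero (hR.isSelfAdjoint hT) ?_ ?_
    · intro ε hε
      -- The value r + μ⁻¹ = 0 is allowed separately because the discreteness hypothesis speaks only
      -- of nonzero spectral points; the bound |r| + ε⁻¹ comes from |μ| ≥ ε.
      have hf : ({s : ℝ | s = 0 ∨
          (s : ℂ) ∈ {z ∈ opSpectrum T \ {0} | ‖z‖ ≤ |r| + ε⁻¹}}).Finite :=
        (Set.finite_singleton 0).union ((hd.1 _).preimage Complex.ofReal_injective.injOn)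
      refine (hf.preimage (f := fun μ : ℝ => r + μ⁻¹) ?_).subset ?_
      · intro a _ b _ h
        simpa using h
      · rintro μ ⟨hμ, hεμ⟩
        have h0 : μ ≠ 0 := by
          rintro rfl
          rw [abs_zero] at hεμ
          exact absurd hεμ (not_le.2 hε)
        by_cases h : r + μ⁻¹ = 0
        · exact Or.inl h
        · refine Or.inr ⟨⟨hR.mem_opSpectrum h0 hμ, ?_⟩, ?_⟩
          · simp only [Set.mem_singleton_iff]
            exact_mod_cast h
          · rw [Complex.norm_real, Real.norm_eq_abs]
            refine (abs_add_le _ _).trans ?_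
            rw [abs_inv]
            gcongr
    · intro μ hμ v hv
      have hc : (μ : ℂ) ≠ 0 := by exact_mod_cast hμ
      refine hx (r + μ⁻¹) v ?_
      obtain ⟨y, hy, hyv⟩ := hR.1 v
      have hyμ : (y : H) = (μ : ℂ) • v := hy.trans hv
      have hv' : v = (μ : ℂ)⁻¹ • (y : H) := by rw [hyμ, inv_smul_smul₀ hc]
      have hTy : T y = ((r + μ⁻¹ : ℝ) : ℂ) • (y : H) := by
        rw [sub_eq_iff_eq_add] at hyv
        rw [hyv, hv']
        push_cast
        module
      rw [hv']
      exact Submodule.smul_mem _ _ (mem_eigenspace_iff.2 ⟨y, hTy, rfl⟩)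
  obtain ⟨y, hy, hyx⟩ := hR.1 x
  have h0 : y = 0 := by
    ext; rw [hy, hRx]; rfl
  rw [← hyx, h0]
  simp

end NCG

/-! ### Coordinates with respect to the eigenprojections -/

namespace NCG

variable {H : Type*} [NormedAddCommGroup H] [InnerProductSpace ℂ H]

/-- `f` is bounded on the eigenvalues of `T`. -/
def IsBoundedOnEigenvalues (T : H →ₗ.[ℂ] H) (f : ℝ → ℝ) : Prop :=
  ∃ C : ℝ, ∀ s : ℝ, eigenspace T (s : ℂ) ≠ ⊥ → |f s| ≤ C

theorem isBoundedOnEigenvalues_inv_abs {T : H →ₗ.[ℂ] H} (hd : IsEssentiallyDiscreteOp T) :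
    IsBoundedOnEigenvalues T fun s => |s|⁻¹ :=
  hd.exists_bound fun s hs => by
    rw [abs_inv, abs_abs]
    exact inv_le_one_of_one_le₀ hs.le

variable [CompleteSpace H]

section EigenProj

variable {T : H →ₗ.[ℂ] H}

theorem eigenProj_mem (hT : IsSelfAdjoint T) (z : ℂ) (x : H) :
    eigenProj T z x ∈ eigenspace T z := by
  have h := Submodule.starProjection_apply_mem (eigenspace T z).topologicalClosure x
  exact (isClosed_eigenspace hT z).submodule_topologicalClosure_eq.le h

theorem eigenProj_eq_self {z : ℂ} {x : H} (hx : x ∈ eigenspace T z) : eigenProj T z x = x :=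
  Submodule.starProjection_eq_self_iff.2 (Submodule.le_topologicalClosure _ hx)

theorem inner_eigenProj_left (z : ℂ) (x y : H) :
    inner ℂ (eigenProj T z x) y = inner ℂ x (eigenProj T z y) :=
  Submodule.inner_starProjection_left_eq_right _ _ _

theorem norm_eigenProj_le (z : ℂ) : ‖eigenProj T z‖ ≤ 1 :=
  Submodule.starProjection_norm_le _

theorem eigenProj_eigenProj_self (hT : IsSelfAdjoint T) (z : ℂ) (x : H) :
    eigenProj T z (eigenProj T z x) = eigenProj T z x :=
  eigenProj_eq_self (eigenProj_mem hT z x)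

theorem eigenProj_eq_zero_of_mem (hT : IsSelfAdjoint T) {s t : ℝ} (h : s ≠ t) {x : H}
    (hx : x ∈ eigenspace T (t : ℂ)) : eigenProj T (s : ℂ) x = 0 := by
  rw [← inner_self_eq_zero (𝕜 := ℂ), inner_eigenProj_left, eigenProj_eigenProj_self hT,
    ← inner_conj_symm,
    Submodule.isOrtho_iff_inner_eq.1 (eigenspace_isOrtho hT h) _ (eigenProj_mem hT _ _) _ hx,
    map_zero]

theorem eigenProj_eigenProj_of_ne (hT : IsSelfAdjoint T) {s t : ℝ} (h : s ≠ t) (x : H) :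
    eigenProj T (s : ℂ) (eigenProj T (t : ℂ) x) = 0 :=
  eigenProj_eq_zero_of_mem hT h (eigenProj_mem hT _ x)

theorem eigenProj_funCalc (hT : IsSelfAdjoint T) {f : ℝ → ℝ} (hf : IsBoundedOnEigenvalues T f)
    (u : ℝ) (x : H) :
    eigenProj T (u : ℂ) (funCalc T f x) = (f u : ℂ) • eigenProj T (u : ℂ) x := by
  obtain ⟨C, hC⟩ := hf
  have h := (funCalc_hasSum hT hC x).mapL (eigenProj T (u : ℂ))
  refine h.unique ?_
  convert hasSum_single u ?_ using 1
  · rw [map_smul, eigenProj_eigenProj_self hT]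
  · intro s hs
    rw [map_smul, eigenProj_eigenProj_of_ne hT hs.symm, smul_zero]

theorem inner_self_eigenProj (hT : IsSelfAdjoint T) (z : ℂ) (x : H) :
    inner ℂ x (eigenProj T z x) = ((‖eigenProj T z x‖ ^ 2 : ℝ) : ℂ) := by
  rw [← eigenProj_eigenProj_self hT, ← inner_eigenProj_left, inner_self_eq_norm_sq_to_K,
    eigenProj_eigenProj_self hT]
  simp

theorem eigenProj_map (hT : IsSelfAdjoint T) (u : ℝ) (x : T.domain) :
    eigenProj T (u : ℂ) (T x) = (u : ℂ) • eigenProj T (u : ℂ) (x : H) := by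
  refine ext_inner_left ℂ fun v => ?_
  obtain ⟨y, hy, hyv⟩ := mem_eigenspace_iff.1 (eigenProj_mem hT (u : ℂ) v)
  rw [← inner_eigenProj_left, inner_smul_right, ← inner_eigenProj_left, ← hyv, ← inner_map_eq hT,
    hy, inner_smul_left, Complex.conj_ofReal]

variable (hT : IsSelfAdjoint T) (hd : IsEssentiallyDiscreteOp T)
include hT hd

/-- This is totality of the eigenvectors. From here on, vector and operator identities are checked
on eigencomponents. -/
theorem ext_eigenProj {x y : H} (h : ∀ s : ℝ, eigenProj T (s : ℂ) x = eigenProj T (s : ℂ) y) :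
    x = y := by
  rw [← sub_eq_zero]
  refine eq_zero_of_forall_inner_eigenspace hT hd fun s v hv => ?_
  rw [← eigenProj_eq_self hv, inner_eigenProj_left, map_sub, h, sub_self, inner_zero_right]

theorem hasSum_eigenProj (x : H) : HasSum (fun s : ℝ => eigenProj T (s : ℂ) x) x := by
  have h1 : ∀ s : ℝ, eigenspace T (s : ℂ) ≠ ⊥ → |(1 : ℝ)| ≤ 1 := by simp
  have h := funCalc_hasSum hT (f := fun _ => 1) h1 x
  have h2 : funCalc T (fun _ => 1) x = x := ext_eigenProj hT hd fun s => by
    rw [eigenProj_funCalc hT ⟨1, h1⟩]; simp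
  simpa [h2] using h

theorem hasSum_norm_sq_eigenProj (x : H) :
    HasSum (fun s : ℝ => ‖eigenProj T (s : ℂ) x‖ ^ 2) (‖x‖ ^ 2) := by
  have h := (hasSum_eigenProj hT hd x).mapL (innerSL ℂ x)
  simp only [innerSL_apply_apply, inner_self_eigenProj hT] at h
  have hx : inner ℂ x x = ((‖x‖ ^ 2 : ℝ) : ℂ) := by
    rw [inner_self_eq_norm_sq_to_K]; simp
  rw [hx] at h
  exact Complex.hasSum_ofReal.1 h

/-- Parseval's identity turns a bound on each component into a bound on the norm. -/
theorem norm_le_of_forall_eigenProj {x y : H} {C : ℝ} (hC : 0 ≤ C)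
    (h : ∀ s : ℝ, ‖eigenProj T (s : ℂ) y‖ ≤ C * ‖eigenProj T (s : ℂ) x‖) : ‖y‖ ≤ C * ‖x‖ := by
  refine le_of_sq_le_sq ?_ (by positivity)
  rw [mul_pow]
  refine hasSum_le (fun s => ?_) (hasSum_norm_sq_eigenProj hT hd y)
    ((hasSum_norm_sq_eigenProj hT hd x).mul_left (C ^ 2))
  rw [← mul_pow]
  gcongr
  exact h s

theorem norm_le_of_forall_eigenspace {x y : H} {C : ℝ} (hC : 0 ≤ C)
    (h : ∀ s : ℝ, eigenspace T (s : ℂ) ≠ ⊥ →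
      ‖eigenProj T (s : ℂ) y‖ ≤ C * ‖eigenProj T (s : ℂ) x‖) : ‖y‖ ≤ C * ‖x‖ := by
  refine norm_le_of_forall_eigenProj hT hd hC fun s => ?_
  by_cases hs : eigenspace T (s : ℂ) = ⊥
  · have := eigenProj_mem hT (s : ℂ) y
    rw [hs, Submodule.mem_bot] at this
    rw [this, norm_zero]
    positivity
  · exact h s hs

theorem ext_matrix {A B : H →L[ℂ] H}
    (h : ∀ (s t : ℝ) (x : H), eigenProj T (t : ℂ) (A (eigenProj T (s : ℂ) x)) =
      eigenProj T (t : ℂ) (B (eigenProj T (s : ℂ) x))) : A = B := by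
  ext x
  have hA := (hasSum_eigenProj hT hd x).mapL A
  have hB := (hasSum_eigenProj hT hd x).mapL B
  refine hA.unique ?_
  convert hB using 2 with s
  exact ext_eigenProj hT hd fun t => h s t x

theorem norm_funCalc_le {f : ℝ → ℝ} {C : ℝ} (hC : 0 ≤ C)
    (hf : ∀ s : ℝ, eigenspace T (s : ℂ) ≠ ⊥ → |f s| ≤ C) : ‖funCalc T f‖ ≤ C := by
  refine ContinuousLinearMap.opNorm_le_bound _ hC fun x => ?_
  refine norm_le_of_forall_eigenspace hT hd hC fun s hs => ?_
  rw [eigenProj_funCalc hT ⟨C, hf⟩, norm_smul, Complex.norm_real, Real.norm_eq_abs]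
  gcongr
  exact hf s hs

theorem funCalc_eigenProj {f : ℝ → ℝ} (hf : IsBoundedOnEigenvalues T f) (s : ℝ) (x : H) :
    funCalc T f (eigenProj T (s : ℂ) x) = (f s : ℂ) • eigenProj T (s : ℂ) x := by
  refine ext_eigenProj hT hd fun t => ?_
  rw [eigenProj_funCalc hT hf, map_smul]
  by_cases h : t = s
  · rw [h]
  · rw [eigenProj_eigenProj_of_ne hT h, smul_zero, smul_zero]

theorem isSelfAdjoint_funCalc {f : ℝ → ℝ} (hf : IsBoundedOnEigenvalues T f) :
    IsSelfAdjoint (funCalc T f) := by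
  rw [ContinuousLinearMap.isSelfAdjoint_iff_isSymmetric]
  intro x y
  change inner ℂ (funCalc T f x) y = inner ℂ x (funCalc T f y)
  have h1 := (hasSum_eigenProj hT hd (funCalc T f x)).mapL (innerSLFlip ℂ y)
  have h2 := (hasSum_eigenProj hT hd (funCalc T f y)).mapL (innerSL ℂ x)
  simp only [innerSLFlip_apply_apply, innerSL_apply_apply] at h1 h2
  refine h1.unique ?_
  convert h2 using 2 with s
  rw [eigenProj_funCalc hT hf, eigenProj_funCalc hT hf, inner_smul_left, inner_smul_right,
    Complex.conj_ofReal, inner_eigenProj_left]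

end EigenProj

/-! ### Factorization of operators from bounds on their forms -/

section Factorization

/-- The assignment A x ↦ S x is well defined and bounded by C on the dense range of A, so it extends
to H. -/
theorem exists_mul_eq_of_norm_le {A S : H →L[ℂ] H} (hA : DenseRange A) {C : ℝ} (hC : 0 ≤ C)
    (h : ∀ x, ‖S x‖ ≤ C * ‖A x‖) : ∃ B : H →L[ℂ] H, B * A = S ∧ ‖B‖ ≤ C := by
  refine ⟨(S : H →ₗ[ℂ] H).extendOfNorm (A : H →ₗ[ℂ] H), ?_, ?_⟩
  · ext x
    exact LinearMap.extendOfNorm_eq (e := (A : H →ₗ[ℂ] H)) hA ⟨C, h⟩ x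
  · exact LinearMap.opNorm_extendOfNorm_le (e := (A : H →ₗ[ℂ] H)) hA hC h

/-- If the form of `T` is bounded by `C ‖A y‖ ‖A x‖`, then `T = A γ A` with `‖γ‖ ≤ C`. -/
theorem exists_eq_mul_mul_of_inner_le {A T : H →L[ℂ] H} (hA : DenseRange A)
    (hsa : IsSelfAdjoint A) {C : ℝ} (hC : 0 ≤ C)
    (h : ∀ x y, ‖inner ℂ y (T x)‖ ≤ C * ‖A y‖ * ‖A x‖) :
    ∃ γ : H →L[ℂ] H, T = A * γ * A ∧ ‖γ‖ ≤ C := by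
  have norm_le : ∀ {c : ℝ} {v : H}, ‖inner ℂ v v‖ ≤ c * ‖v‖ → 0 ≤ c → ‖v‖ ≤ c := by
    intro c v hv hc
    rw [inner_self_eq_norm_sq_to_K, norm_pow, RCLike.norm_ofReal, abs_norm, sq] at hv
    rcases (norm_nonneg v).eq_or_lt with h0 | h0
    · rwa [← h0]
    · exact le_of_mul_le_mul_right hv h0
  -- The right factor A is removed first. The crude constant C ‖A‖ only serves to make T₁ bounded;
  -- the sharp constant C reappears when the left factor is removed from the adjoint of T₁.
  obtain ⟨T₁, hT₁, -⟩ := exists_mul_eq_of_norm_le (S := T) hA (C := C * ‖A‖) (by positivity)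
    fun x => by
      refine norm_le ((h x (T x)).trans ?_) (by positivity)
      calc C * ‖A (T x)‖ * ‖A x‖ ≤ C * (‖A‖ * ‖T x‖) * ‖A x‖ := by
            gcongr; exact A.le_opNorm _
        _ = _ := by ring
  have h1 : ∀ y z, ‖inner ℂ y (T₁ z)‖ ≤ C * ‖A y‖ * ‖z‖ := by
    intro y z
    refine hA.induction_on (p := fun z => ‖inner ℂ y (T₁ z)‖ ≤ C * ‖A y‖ * ‖z‖) z ?_ fun x => ?_
    · exact isClosed_le (by fun_prop) (by fun_prop)
    · have : T₁ (A x) = T x := by rw [← hT₁]; rfl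
      rw [this]
      exact h x y
  obtain ⟨T₂, hT₂, hC₂⟩ := exists_mul_eq_of_norm_le (S := star T₁) hA hC fun y => by
    refine norm_le ?_ (by positivity)
    rw [ContinuousLinearMap.star_eq_adjoint, ContinuousLinearMap.adjoint_inner_left]
    exact h1 _ _
  refine ⟨star T₂, ?_, by rwa [norm_star]⟩
  have h2 : A * star T₂ = T₁ := by
    have := congrArg star hT₂
    rwa [star_mul, star_star, hsa.star_eq] at this
  rw [h2, hT₁]

end Factorization

end NCG

/-! ### Integral formula for the regularized sign and the form estimate -/

namespace NCG

section Integral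

open MeasureTheory

theorem inv_sq_add_eq {m : ℝ} (hm : 0 < m) (r : ℝ) :
    (r ^ 2 + m)⁻¹ = m⁻¹ * (1 + (r / √m) ^ 2)⁻¹ := by
  rw [div_pow, Real.sq_sqrt hm.le, ← mul_inv]
  congr 1
  field_simp
  ring

theorem integrable_inv_sq_add {m : ℝ} (hm : 0 < m) :
    Integrable fun r : ℝ => (r ^ 2 + m)⁻¹ := by
  simp only [inv_sq_add_eq hm]
  exact (integrable_inv_one_add_sq.comp_div (Real.sqrt_ne_zero'.2 hm)).const_mul _

theorem integral_inv_sq_add {m : ℝ} (hm : 0 < m) :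
    ∫ r : ℝ, (r ^ 2 + m)⁻¹ = Real.pi * (√m)⁻¹ := by
  simp only [inv_sq_add_eq hm]
  rw [integral_const_mul, Measure.integral_comp_div (fun x : ℝ => (1 + x ^ 2)⁻¹),
    integral_univ_inv_one_add_sq, abs_of_nonneg (Real.sqrt_nonneg m), smul_eq_mul]
  have h := Real.sq_sqrt hm.le
  have h0 : √m ≠ 0 := Real.sqrt_ne_zero'.2 hm
  have : m⁻¹ = (√m)⁻¹ * (√m)⁻¹ := by rw [← mul_inv, ← sq, h]
  rw [this]
  field_simp

end Integral

/-- The function `s ↦ s / √(ε + s²)`. -/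
def regSign (ε s : ℝ) : ℝ := s / √(ε + s ^ 2)

@[simp] theorem regSign_zero_right (ε : ℝ) : regSign ε 0 = 0 := by simp [regSign]

theorem regSign_zero_left : regSign 0 = Real.sign := by
  ext s
  rw [regSign, zero_add, Real.sqrt_sq_eq_abs]
  rcases lt_trichotomy s 0 with h | rfl | h
  · rw [Real.sign_of_neg h, abs_of_neg h, div_neg, div_self h.ne]
  · simp
  · rw [Real.sign_of_pos h, abs_of_pos h, div_self h.ne']

theorem abs_regSign_le {ε : ℝ} (hε : 0 ≤ ε) (s : ℝ) : |regSign ε s| ≤ 1 := by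
  rw [regSign, abs_div, abs_of_nonneg (Real.sqrt_nonneg _)]
  refine div_le_one_of_le₀ (Real.abs_le_sqrt ?_) (Real.sqrt_nonneg _)
  linarith

variable {H : Type*} [NormedAddCommGroup H] [InnerProductSpace ℂ H] [CompleteSpace H]
variable {T : H →ₗ.[ℂ] H} (hT : IsSelfAdjoint T) (hd : IsEssentiallyDiscreteOp T)

section Estimate

include hT hd in
theorem norm_sq_sum_smul_eigenProj (U : Finset ℝ) (w : ℝ → ℝ) (x : H) :
    ‖∑ s ∈ U, (w s : ℂ) • eigenProj T (s : ℂ) x‖ ^ 2 =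
      ∑ s ∈ U, w s ^ 2 * ‖eigenProj T (s : ℂ) x‖ ^ 2 := by
  have hu : ∀ u : ℝ, eigenProj T (u : ℂ) (∑ s ∈ U, (w s : ℂ) • eigenProj T (s : ℂ) x) =
      if u ∈ U then (w u : ℂ) • eigenProj T (u : ℂ) x else 0 := by
    intro u
    rw [map_sum, ← Finset.sum_ite_eq U u fun s => (w s : ℂ) • eigenProj T (s : ℂ) x]
    refine Finset.sum_congr rfl fun s _ => ?_
    rw [map_smul]
    split_ifs with h
    · rw [h, eigenProj_eigenProj_self hT]
    · rw [eigenProj_eigenProj_of_ne hT h, smul_zero]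
  refine (hasSum_norm_sq_eigenProj hT hd _).unique ?_
  have h : ∀ s ∈ U, w s ^ 2 * ‖eigenProj T (s : ℂ) x‖ ^ 2 =
      ‖eigenProj T (s : ℂ) (∑ s ∈ U, (w s : ℂ) • eigenProj T (s : ℂ) x)‖ ^ 2 := by
    intro s hs
    rw [hu, if_pos hs, norm_smul, mul_pow, Complex.norm_real, Real.norm_eq_abs, sq_abs]
  rw [Finset.sum_congr rfl h]
  refine hasSum_sum_of_ne_finset_zero fun s hs => ?_
  rw [hu, if_neg hs]
  simp

variable {a X : H →L[ℂ] H}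
  (hX : ∀ (s t : ℝ) (x : H), eigenProj T (t : ℂ) (X (eigenProj T (s : ℂ) x)) =
    ((t - s : ℝ) : ℂ) • eigenProj T (t : ℂ) (a (eigenProj T (s : ℂ) x)))

include hT hX in
theorem inner_commutator (s t : ℝ) (x y : H) :
    inner ℂ (eigenProj T (t : ℂ) y) (X (eigenProj T (s : ℂ) x)) =
      ((t - s : ℝ) : ℂ) * inner ℂ (eigenProj T (t : ℂ) y) (a (eigenProj T (s : ℂ) x)) := by
  rw [← eigenProj_eigenProj_self hT (t : ℂ) y, inner_eigenProj_left, hX, inner_smul_right,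
    ← inner_eigenProj_left]

-- The pointwise estimate under the integral: the symbol t d_t - s d_s splits into two compressions
-- of X, by c d(D) and by D d(D), and their weights satisfy (c d_s)² + (s d_s)² = d_s. Excluding s =
-- 0 keeps r² + ε + s² nonzero even for ε = 0 and r = 0.
include hT hd hX in
theorem norm_sum_integrand_le {ε : ℝ} (hε : 0 ≤ ε) {U : Finset ℝ} (hU : 0 ∉ U) (x y : H)
    (r : ℝ) :
    ‖∑ s ∈ U, ∑ t ∈ U, ((t * (r ^ 2 + (ε + t ^ 2))⁻¹ - s * (r ^ 2 + (ε + s ^ 2))⁻¹ : ℝ) : ℂ) *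
        inner ℂ (eigenProj T (t : ℂ) y) (a (eigenProj T (s : ℂ) x))‖ ≤
      ∑ s ∈ U, (r ^ 2 + (ε + s ^ 2))⁻¹ *
        (‖X‖ / 2 * (‖eigenProj T (s : ℂ) y‖ ^ 2 + ‖eigenProj T (s : ℂ) x‖ ^ 2)) := by
  set d : ℝ → ℝ := fun s => (r ^ 2 + (ε + s ^ 2))⁻¹ with hd'
  set c := √(r ^ 2 + ε) with hc
  have hc2 : c ^ 2 = r ^ 2 + ε := Real.sq_sqrt (by positivity)
  have hm : ∀ s ∈ U, r ^ 2 + (ε + s ^ 2) ≠ 0 := by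
    intro s hs
    have : s ≠ 0 := fun h => hU (h ▸ hs)
    positivity
  set sx : (ℝ → ℝ) → H := fun w => ∑ s ∈ U, (w s : ℂ) • eigenProj T (s : ℂ) x with hsx
  set sy : (ℝ → ℝ) → H := fun w => ∑ s ∈ U, (w s : ℂ) • eigenProj T (s : ℂ) y with hsy
  have hin : ∀ w : ℝ → ℝ, inner ℂ (sy w) (X (sx w)) = ∑ s ∈ U, ∑ t ∈ U,
      ((w t * w s * (t - s) : ℝ) : ℂ) *
        inner ℂ (eigenProj T (t : ℂ) y) (a (eigenProj T (s : ℂ) x)) := by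
    intro w
    simp only [hsx, hsy, map_sum, map_smul, inner_sum, sum_inner, inner_smul_left,
      inner_smul_right, inner_commutator hT hX, Complex.conj_ofReal]
    refine Finset.sum_congr rfl fun s _ => ?_
    rw [Finset.mul_sum]
    refine Finset.sum_congr rfl fun t _ => ?_
    push_cast
    ring
  have hsplit : ∑ s ∈ U, ∑ t ∈ U, ((t * d t - s * d s : ℝ) : ℂ) *
      inner ℂ (eigenProj T (t : ℂ) y) (a (eigenProj T (s : ℂ) x)) =
      inner ℂ (sy fun s => c * d s) (X (sx fun s => c * d s)) -
        inner ℂ (sy fun s => s * d s) (X (sx fun s => s * d s)) := by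
    rw [hin, hin, ← Finset.sum_sub_distrib]
    refine Finset.sum_congr rfl fun s hs => ?_
    rw [← Finset.sum_sub_distrib]
    refine Finset.sum_congr rfl fun t ht => ?_
    rw [← sub_mul, ← Complex.ofReal_sub]
    congr 2
    have h1 : c * d t * (c * d s) * (t - s) - t * d t * (s * d s) * (t - s) =
        d t * d s * (t * (c ^ 2 + s ^ 2) - s * (c ^ 2 + t ^ 2)) := by ring
    have h2 : d s * (c ^ 2 + s ^ 2) = 1 := by
      rw [hc2, add_assoc]; exact inv_mul_cancel₀ (hm s hs)
    have h3 : d t * (c ^ 2 + t ^ 2) = 1 := by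
      rw [hc2, add_assoc]; exact inv_mul_cancel₀ (hm t ht)
    rw [h1]
    linear_combination (-t * d t) * h2 + s * d s * h3
  have hbound : ∀ w : ℝ → ℝ, ‖inner ℂ (sy w) (X (sx w))‖ ≤
      ∑ s ∈ U, w s ^ 2 *
        (‖X‖ / 2 * (‖eigenProj T (s : ℂ) y‖ ^ 2 + ‖eigenProj T (s : ℂ) x‖ ^ 2)) := by
    intro w
    calc ‖inner ℂ (sy w) (X (sx w))‖ ≤ ‖sy w‖ * (‖X‖ * ‖sx w‖) :=
          (norm_inner_le_norm _ _).trans (by gcongr; exact X.le_opNorm _)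
      _ ≤ ‖X‖ / 2 * (‖sy w‖ ^ 2 + ‖sx w‖ ^ 2) := by
          -- The arithmetic-geometric mean inequality makes the bound additive in s, so that it can
          -- be integrated term by term.
          nlinarith [mul_nonneg (norm_nonneg X) (sq_nonneg (‖sy w‖ - ‖sx w‖))]
      _ = _ := by
          rw [norm_sq_sum_smul_eigenProj hT hd, norm_sq_sum_smul_eigenProj hT hd,
            ← Finset.sum_add_distrib, Finset.mul_sum]
          refine Finset.sum_congr rfl fun s _ => ?_
          ring
  rw [hsplit]
  refine (norm_sub_le _ _).trans ((add_le_add (hbound _) (hbound _)).trans (le_of_eq ?_))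
  rw [← Finset.sum_add_distrib]
  refine Finset.sum_congr rfl fun s hs => ?_
  rw [← add_mul]
  congr 1
  have h2 : d s * (c ^ 2 + s ^ 2) = 1 := by
    rw [hc2, add_assoc]; exact inv_mul_cancel₀ (hm s hs)
  change (c * d s) ^ 2 + (s * d s) ^ 2 = d s
  linear_combination d s * h2

-- Integration of the previous estimate over r: the left side yields π times the sum with `regSign`,
-- the weights on the right yield π / √(ε + s²).
include hT hd hX in
theorem norm_sum_regSign_le {ε : ℝ} (hε : 0 ≤ ε) {U : Finset ℝ} (hU : 0 ∉ U) (x y : H) :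
    ‖∑ s ∈ U, ∑ t ∈ U, ((regSign ε t - regSign ε s : ℝ) : ℂ) *
        inner ℂ (eigenProj T (t : ℂ) y) (a (eigenProj T (s : ℂ) x))‖ ≤
      ∑ s ∈ U, |s|⁻¹ *
        (‖X‖ / 2 * (‖eigenProj T (s : ℂ) y‖ ^ 2 + ‖eigenProj T (s : ℂ) x‖ ^ 2)) := by
  have hpos : ∀ s ∈ U, 0 < ε + s ^ 2 := by
    intro s hs
    have : s ≠ 0 := fun h => hU (h ▸ hs)
    positivity
  have hI : ∀ s ∈ U, MeasureTheory.Integrable fun r : ℝ => s * (r ^ 2 + (ε + s ^ 2))⁻¹ :=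
    fun s hs => (integrable_inv_sq_add (hpos s hs)).const_mul s
  have hint : ∀ s ∈ U, ∫ r : ℝ, s * (r ^ 2 + (ε + s ^ 2))⁻¹ = Real.pi * regSign ε s := by
    intro s hs
    rw [MeasureTheory.integral_const_mul, integral_inv_sq_add (hpos s hs), regSign]
    ring
  have h := MeasureTheory.norm_integral_le_of_norm_le (μ := MeasureTheory.volume)
    (MeasureTheory.integrable_finsetSum U fun s hs =>
      (integrable_inv_sq_add (hpos s hs)).mul_const
        (‖X‖ / 2 * (‖eigenProj T (s : ℂ) y‖ ^ 2 + ‖eigenProj T (s : ℂ) x‖ ^ 2)))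
    (Filter.Eventually.of_forall fun r => norm_sum_integrand_le hT hd hX hε hU x y r)
  have hL : ∫ r : ℝ, ∑ s ∈ U, ∑ t ∈ U,
      ((t * (r ^ 2 + (ε + t ^ 2))⁻¹ - s * (r ^ 2 + (ε + s ^ 2))⁻¹ : ℝ) : ℂ) *
        inner ℂ (eigenProj T (t : ℂ) y) (a (eigenProj T (s : ℂ) x)) =
      Real.pi * ∑ s ∈ U, ∑ t ∈ U, ((regSign ε t - regSign ε s : ℝ) : ℂ) *
        inner ℂ (eigenProj T (t : ℂ) y) (a (eigenProj T (s : ℂ) x)) := by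
    rw [MeasureTheory.integral_finsetSum, Finset.mul_sum]
    · refine Finset.sum_congr rfl fun s hs => ?_
      rw [MeasureTheory.integral_finsetSum, Finset.mul_sum]
      · refine Finset.sum_congr rfl fun t ht => ?_
        rw [MeasureTheory.integral_mul_const, integral_complex_ofReal,
          MeasureTheory.integral_sub (hI t ht) (hI s hs), hint t ht, hint s hs, ← mul_sub,
          Complex.ofReal_mul, mul_assoc]
      · exact fun t ht => (((hI t ht).sub (hI s hs)).ofReal).mul_const _
    · exact fun s hs => MeasureTheory.integrable_finsetSum _ fun t ht =>
        (((hI t ht).sub (hI s hs)).ofReal).mul_const _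
  rw [hL, MeasureTheory.integral_finsetSum _ fun s hs =>
    (integrable_inv_sq_add (hpos s hs)).mul_const _, norm_mul, Complex.norm_real,
    Real.norm_eq_abs, abs_of_pos Real.pi_pos] at h
  refine le_of_mul_le_mul_left (h.trans ?_) Real.pi_pos
  rw [Finset.mul_sum]
  refine Finset.sum_le_sum fun s hs => ?_
  have hs0 : s ≠ 0 := fun h => hU (h ▸ hs)
  rw [MeasureTheory.integral_mul_const, integral_inv_sq_add (hpos s hs), mul_assoc]
  have := Real.pi_pos.le
  have := abs_pos.2 hs0
  gcongr
  -- Since √(ε + s²) ≥ |s|, the bound no longer depends on ε, and one estimate serves both phases.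
  exact Real.abs_le_sqrt (by linarith)

end Estimate

theorem denseRange_of_isSelfAdjoint {A : H →L[ℂ] H} (hA : IsSelfAdjoint A)
    (h : ∀ x, A x = 0 → x = 0) : DenseRange A := by
  have h1 : (LinearMap.range (A : H →ₗ[ℂ] H))ᗮ = ⊥ := by
    rw [Submodule.eq_bot_iff]
    intro x hx
    refine h x ?_
    refine ext_inner_left ℂ fun v => ?_
    have h2 := (ContinuousLinearMap.isSelfAdjoint_iff_isSymmetric.1 hA) v x
    simp only [ContinuousLinearMap.coe_coe] at h2
    rw [inner_zero_right, ← h2]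
    exact hx _ ⟨v, rfl⟩
  have h3 := Submodule.topologicalClosure_eq_top_iff.2 h1
  rw [← Submodule.dense_iff_topologicalClosure_eq_top] at h3
  rwa [LinearMap.coe_range] at h3

end NCG

/-! ### The decomposition of the quantum differential -/

namespace NCG

theorem isBoundedOnEigenvalues_sqrt_inv_abs {H : Type*} [NormedAddCommGroup H]
    [InnerProductSpace ℂ H] {T : H →ₗ.[ℂ] H} (hd : IsEssentiallyDiscreteOp T) :
    IsBoundedOnEigenvalues T fun s => √(|s|⁻¹) :=
  hd.exists_bound fun s hs => by
    rw [abs_of_nonneg (Real.sqrt_nonneg _), Real.sqrt_le_one]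
    exact inv_le_one_of_one_le₀ hs.le

theorem isBoundedOnEigenvalues_regSign {H : Type*} [NormedAddCommGroup H]
    [InnerProductSpace ℂ H] (T : H →ₗ.[ℂ] H) {ε : ℝ} (hε : 0 ≤ ε) :
    IsBoundedOnEigenvalues T (regSign ε) := ⟨1, fun s _ => abs_regSign_le hε s⟩

/-- `|s|^{-1/2}`, with the value `1` at `0`. -/
def sqrtInvAbsOne (s : ℝ) : ℝ := if s = 0 then 1 else √(|s|⁻¹)

theorem sqrtInvAbsOne_ne_zero (s : ℝ) : sqrtInvAbsOne s ≠ 0 := by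
  rw [sqrtInvAbsOne]
  split_ifs with h
  · exact one_ne_zero
  · exact Real.sqrt_ne_zero'.2 (by positivity)

theorem sqrtInvAbsOne_sq {s : ℝ} (hs : s ≠ 0) : sqrtInvAbsOne s ^ 2 = |s|⁻¹ := by
  rw [sqrtInvAbsOne, if_neg hs, Real.sq_sqrt (by positivity)]

theorem isBoundedOnEigenvalues_sqrtInvAbsOne {H : Type*} [NormedAddCommGroup H]
    [InnerProductSpace ℂ H] {T : H →ₗ.[ℂ] H} (hd : IsEssentiallyDiscreteOp T) :
    IsBoundedOnEigenvalues T sqrtInvAbsOne :=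
  hd.exists_bound fun s hs => by
    rw [sqrtInvAbsOne, if_neg (by rintro rfl; simp at hs; linarith),
      abs_of_nonneg (Real.sqrt_nonneg _), Real.sqrt_le_one]
    exact inv_le_one_of_one_le₀ hs.le

variable {H : Type*} [NormedAddCommGroup H] [InnerProductSpace ℂ H] [CompleteSpace H]
variable {T : H →ₗ.[ℂ] H} (hT : IsSelfAdjoint T) (hd : IsEssentiallyDiscreteOp T)
variable {a X : H →L[ℂ] H}
  (hX : ∀ (s t : ℝ) (x : H), eigenProj T (t : ℂ) (X (eigenProj T (s : ℂ) x)) =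
    ((t - s : ℝ) : ℂ) • eigenProj T (t : ℂ) (a (eigenProj T (s : ℂ) x)))

section Form

variable {ε : ℝ} (hε : 0 ≤ ε) {L : H →L[ℂ] H}
  (hL : ∀ (s t : ℝ) (x : H), eigenProj T (t : ℂ) (L (eigenProj T (s : ℂ) x)) =
    if s = 0 ∨ t = 0 then 0 else (Complex.I * ((regSign ε t - regSign ε s : ℝ) : ℂ)) •
      eigenProj T (t : ℂ) (a (eigenProj T (s : ℂ) x)))

include hT hd hX hε hL

/-- L is the part of i[G, a] away from the kernel, so finite partial sums over eigenvalues lose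
nothing when 0 is erased. The estimate for finite sums then passes to the limit. -/
theorem norm_inner_le_add (x y : H) :
    ‖inner ℂ y (L x)‖ ≤ ‖X‖ / 2 *
      (‖funCalc T sqrtInvAbsOne y‖ ^ 2 + ‖funCalc T sqrtInvAbsOne x‖ ^ 2) := by
  have hlim : Filter.Tendsto (fun U : Finset ℝ => ‖inner ℂ (∑ s ∈ U, eigenProj T (s : ℂ) y)
      (L (∑ s ∈ U, eigenProj T (s : ℂ) x))‖) Filter.atTop (nhds ‖inner ℂ y (L x)‖) :=
    ((hasSum_eigenProj hT hd y).inner ((L.continuous.tendsto _).comp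
      (hasSum_eigenProj hT hd x))).norm
  refine le_of_tendsto hlim (Filter.Eventually.of_forall fun U => ?_)
  have hentry : ∀ s t : ℝ, inner ℂ (eigenProj T (t : ℂ) y) (L (eigenProj T (s : ℂ) x)) =
      if s = 0 ∨ t = 0 then 0 else Complex.I * (((regSign ε t - regSign ε s : ℝ) : ℂ) *
        inner ℂ (eigenProj T (t : ℂ) y) (a (eigenProj T (s : ℂ) x))) := by
    intro s t
    rw [← eigenProj_eigenProj_self hT (t : ℂ) y, inner_eigenProj_left, hL]
    split_ifs
    · rw [inner_zero_right]
    · rw [inner_smul_right, ← inner_eigenProj_left, mul_assoc]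
  have hsum : inner ℂ (∑ s ∈ U, eigenProj T (s : ℂ) y) (L (∑ s ∈ U, eigenProj T (s : ℂ) x)) =
      Complex.I * ∑ s ∈ U.erase 0, ∑ t ∈ U.erase 0, ((regSign ε t - regSign ε s : ℝ) : ℂ) *
        inner ℂ (eigenProj T (t : ℂ) y) (a (eigenProj T (s : ℂ) x)) := by
    simp only [map_sum, inner_sum, sum_inner, hentry]
    rw [← Finset.sum_erase U (a := (0 : ℝ)) (by simp), Finset.mul_sum]
    refine Finset.sum_congr rfl fun s hs => ?_
    rw [← Finset.sum_erase U (a := (0 : ℝ)) (by simp), Finset.mul_sum]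
    refine Finset.sum_congr rfl fun t ht => ?_
    rw [if_neg (not_or.2 ⟨Finset.ne_of_mem_erase hs, Finset.ne_of_mem_erase ht⟩)]
  rw [hsum, norm_mul, Complex.norm_I, one_mul]
  refine (norm_sum_regSign_le hT hd hX hε (Finset.notMem_erase 0 U) x y).trans ?_
  have hA := isBoundedOnEigenvalues_sqrtInvAbsOne hd
  have h1 : ∀ z : H, ∑ s ∈ U.erase 0, |s|⁻¹ * ‖eigenProj T (s : ℂ) z‖ ^ 2 ≤
      ‖funCalc T sqrtInvAbsOne z‖ ^ 2 := by
    intro z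
    have h2 := sum_le_hasSum (U.erase 0) (fun s _ => by positivity)
      (hasSum_norm_sq_eigenProj hT hd (funCalc T sqrtInvAbsOne z))
    refine (Finset.sum_le_sum fun s hs => ?_).trans h2
    rw [eigenProj_funCalc hT hA, norm_smul, mul_pow, Complex.norm_real, Real.norm_eq_abs, sq_abs,
      sqrtInvAbsOne_sq (Finset.ne_of_mem_erase hs)]
  calc _ = ‖X‖ / 2 * (∑ s ∈ U.erase 0, |s|⁻¹ * ‖eigenProj T (s : ℂ) y‖ ^ 2 +
        ∑ s ∈ U.erase 0, |s|⁻¹ * ‖eigenProj T (s : ℂ) x‖ ^ 2) := by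
        rw [← Finset.sum_add_distrib, Finset.mul_sum]
        refine Finset.sum_congr rfl fun s _ => ?_
        ring
    _ ≤ _ := by gcongr <;> exact h1 _

omit hX hε hL in
theorem eq_zero_of_funCalc_sqrtInvAbsOne {x : H} (hx : funCalc T sqrtInvAbsOne x = 0) :
    x = 0 := by
  refine ext_eigenProj hT hd fun s => ?_
  have h := eigenProj_funCalc hT (isBoundedOnEigenvalues_sqrtInvAbsOne hd) s x
  rw [hx, map_zero, eq_comm, smul_eq_zero] at h
  rw [map_zero]
  exact h.resolve_left (by exact_mod_cast sqrtInvAbsOne_ne_zero s)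

theorem norm_inner_le_mul (x y : H) :
    ‖inner ℂ y (L x)‖ ≤ ‖X‖ * ‖funCalc T sqrtInvAbsOne y‖ * ‖funCalc T sqrtInvAbsOne x‖ := by
  by_cases hy : y = 0
  · simp [hy]
  by_cases hx : x = 0
  · simp [hx]
  have hp : 0 < ‖funCalc T sqrtInvAbsOne y‖ :=
    norm_pos_iff.2 fun h => hy (eq_zero_of_funCalc_sqrtInvAbsOne hT hd h)
  have hq : 0 < ‖funCalc T sqrtInvAbsOne x‖ :=
    norm_pos_iff.2 fun h => hx (eq_zero_of_funCalc_sqrtInvAbsOne hT hd h)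
  set p := ‖funCalc T sqrtInvAbsOne y‖
  set q := ‖funCalc T sqrtInvAbsOne x‖
  -- Rescaling x by p and y by q makes the two squares equal, which turns the additive bound into
  -- the product bound.
  have h := norm_inner_le_add hT hd hX hε hL ((p : ℂ) • x) ((q : ℂ) • y)
  simp only [map_smul, norm_smul, inner_smul_left, inner_smul_right, norm_mul,
    Complex.conj_ofReal, Complex.norm_real, Real.norm_eq_abs, abs_of_pos hp, abs_of_pos hq] at h
  have h' : p * (q * ‖inner ℂ y (L x)‖) ≤ ‖X‖ / 2 * ((q * p) ^ 2 + (p * q) ^ 2) := h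
  refine le_of_mul_le_mul_left ?_ (mul_pos hp hq)
  linarith

theorem exists_eq_funCalc_mul_mul :
    ∃ γ : H →L[ℂ] H, L = funCalc T sqrtInvAbsOne * γ * funCalc T sqrtInvAbsOne ∧ ‖γ‖ ≤ ‖X‖ := by
  have hsa := isSelfAdjoint_funCalc hT hd (isBoundedOnEigenvalues_sqrtInvAbsOne hd)
  exact exists_eq_mul_mul_of_inner_le
    (denseRange_of_isSelfAdjoint hsa fun x hx => eq_zero_of_funCalc_sqrtInvAbsOne hT hd hx)
    hsa (norm_nonneg _) (norm_inner_le_mul hT hd hX hε hL)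

end Form

include hT in
theorem eigenProj_zero_eigenProj (s : ℝ) (x : H) :
    eigenProj T 0 (eigenProj T (s : ℂ) x) =
      ((if s = 0 then 1 else 0 : ℝ) : ℂ) • eigenProj T (s : ℂ) x := by
  rw [← Complex.ofReal_zero]
  split_ifs with h
  · rw [h, eigenProj_eigenProj_self hT]; simp
  · rw [eigenProj_eigenProj_of_ne hT (Ne.symm h)]; simp

include hT in
theorem eigenProj_eigenProj_zero (t : ℝ) (x : H) :
    eigenProj T (t : ℂ) (eigenProj T 0 x) =
      ((if t = 0 then 1 else 0 : ℝ) : ℂ) • eigenProj T (t : ℂ) x := by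
  rw [← Complex.ofReal_zero]
  split_ifs with h
  · rw [h, eigenProj_eigenProj_self hT]; simp
  · rw [eigenProj_eigenProj_of_ne hT h]; simp

/-- The eigenvalue of `P₀ + T (ε + T²)^{-1/2}` on the eigenspace of `T` for `s`. -/
def phaseFun (ε s : ℝ) : ℝ := (if s = 0 then 1 else 0) + regSign ε s

include hT hd in
theorem eigenProj_quantumDiff {ε : ℝ} (hε : 0 ≤ ε) (s t : ℝ) (x : H) :
    eigenProj T (t : ℂ) (quantumDiff (eigenProj T 0 + funCalc T (regSign ε)) a
      (eigenProj T (s : ℂ) x)) = (Complex.I * ((phaseFun ε t - phaseFun ε s : ℝ) : ℂ)) •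
        eigenProj T (t : ℂ) (a (eigenProj T (s : ℂ) x)) := by
  have hb := isBoundedOnEigenvalues_regSign T hε
  change eigenProj T (t : ℂ) (Complex.I • ((eigenProj T 0 (a (eigenProj T (s : ℂ) x)) +
    funCalc T (regSign ε) (a (eigenProj T (s : ℂ) x))) -
      a (eigenProj T 0 (eigenProj T (s : ℂ) x) +
        funCalc T (regSign ε) (eigenProj T (s : ℂ) x)))) = _
  rw [eigenProj_zero_eigenProj hT, funCalc_eigenProj hT hd hb, map_smul, map_sub, map_add,
    eigenProj_eigenProj_zero hT, eigenProj_funCalc hT hb, ← add_smul, ← add_smul, map_smul,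
    map_smul, ← sub_smul, smul_smul]
  simp only [phaseFun]
  push_cast
  rfl

theorem abs_sign_mul_le {ε : ℝ} (hε : 0 ≤ ε) (s : ℝ) :
    |Real.sign s * (regSign ε s - 1)| ≤ 2 := by
  have h1 : |Real.sign s| ≤ 1 := by
    rcases Real.sign_apply_eq s with h | h | h <;> simp [h]
  have h2 : |regSign ε s - 1| ≤ 2 := by
    have := abs_le.1 (abs_regSign_le hε s)
    rw [abs_le]
    constructor <;> linarith
  rw [abs_mul]
  nlinarith [abs_nonneg (regSign ε s - 1)]

-- Four blocks relative to ker T and its complement: the diagonal kernel block is 0, the two mixed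
-- blocks give α and β, and the remaining block L gives γ.
include hT hd hX in
theorem exists_quantumDiff_eq {ε : ℝ} (hε : 0 ≤ ε) :
    ∃ α β γ : H →L[ℂ] H,
      quantumDiff (eigenProj T 0 + funCalc T (regSign ε)) a =
          α * funCalc T (fun x => |x|⁻¹) + funCalc T (fun x => |x|⁻¹) * β +
            funCalc T (fun x => √(|x|⁻¹)) * γ * funCalc T (fun x => √(|x|⁻¹)) ∧
        ‖α‖ ≤ 2 * ‖X‖ ∧ ‖β‖ ≤ 2 * ‖X‖ ∧ ‖γ‖ ≤ ‖X‖ := by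
  -- Chosen so that |u|⁻¹ φ(u) u = `regSign ε u` - 1: the factor u comes from X, since one of the
  -- two eigenvalues is 0, and |u|⁻¹ is the factor |D|⁻¹ required in the statement. The constant 2
  -- is the bound of |`regSign ε u` - 1|.
  set φ : ℝ → ℝ := fun s => Real.sign s * (regSign ε s - 1) with hφ
  have hφb : IsBoundedOnEigenvalues T φ := ⟨2, fun s _ => abs_sign_mul_le hε s⟩
  have hφn : ‖funCalc T φ‖ ≤ 2 := norm_funCalc_le hT hd zero_le_two fun s _ => abs_sign_mul_le hε s
  have hAb := isBoundedOnEigenvalues_inv_abs hd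
  have hBb := isBoundedOnEigenvalues_sqrt_inv_abs hd
  have hCb := isBoundedOnEigenvalues_sqrtInvAbsOne hd
  have hP := norm_eigenProj_le (T := T) 0
  set q := quantumDiff (eigenProj T 0 + funCalc T (regSign ε)) a with hq
  have hqe := fun s t x => eigenProj_quantumDiff hT hd (a := a) hε s t x
  rw [← hq] at hqe
  set L : H →L[ℂ] H := (1 - eigenProj T 0) * q * (1 - eigenProj T 0) with hLdef
  have hL : ∀ (s t : ℝ) (x : H), eigenProj T (t : ℂ) (L (eigenProj T (s : ℂ) x)) =
      if s = 0 ∨ t = 0 then 0 else (Complex.I * ((regSign ε t - regSign ε s : ℝ) : ℂ)) •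
        eigenProj T (t : ℂ) (a (eigenProj T (s : ℂ) x)) := by
    intro s t x
    change eigenProj T (t : ℂ) (q (eigenProj T (s : ℂ) x - eigenProj T 0 (eigenProj T (s : ℂ) x)) -
      eigenProj T 0 (q (eigenProj T (s : ℂ) x - eigenProj T 0 (eigenProj T (s : ℂ) x)))) = _
    rw [map_sub, eigenProj_eigenProj_zero hT, eigenProj_zero_eigenProj hT, map_sub, map_smul,
      map_sub, map_smul, hqe]
    by_cases hs : s = 0
    · simp [hs]
    · by_cases ht : t = 0
      · simp [ht]
      · simp [hs, ht, phaseFun]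
  -- The factorization uses |s|^{-1/2} with value 1 at 0, so that the factor has dense range. Using
  -- |D|^{-1/2} afterwards changes only blocks that involve the kernel, where L vanishes as well.
  obtain ⟨γ, hγ, hγn⟩ := exists_eq_funCalc_mul_mul hT hd hX hε hL
  refine ⟨Complex.I • (eigenProj T 0 * X * funCalc T φ),
    Complex.I • (funCalc T φ * X * eigenProj T 0), γ, ?_, ?_, ?_, hγn⟩
  · refine ext_matrix hT hd fun s t x => ?_
    have e : eigenProj T (t : ℂ) ((Complex.I • (eigenProj T 0 * X * funCalc T φ) *
          funCalc T (fun x => |x|⁻¹) + funCalc T (fun x => |x|⁻¹) *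
            Complex.I • (funCalc T φ * X * eigenProj T 0) +
            funCalc T (fun x => √(|x|⁻¹)) * γ * funCalc T (fun x => √(|x|⁻¹)))
              (eigenProj T (s : ℂ) x)) =
        eigenProj T (t : ℂ) (Complex.I • eigenProj T 0 (X (funCalc T φ
          (funCalc T (fun x => |x|⁻¹) (eigenProj T (s : ℂ) x))))) +
        eigenProj T (t : ℂ) (funCalc T (fun x => |x|⁻¹) (Complex.I • funCalc T φ
          (X (eigenProj T 0 (eigenProj T (s : ℂ) x))))) +
        eigenProj T (t : ℂ) (funCalc T (fun x => √(|x|⁻¹)) (γ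
          (funCalc T (fun x => √(|x|⁻¹)) (eigenProj T (s : ℂ) x)))) := by
      rw [← map_add, ← map_add]
      rfl
    have hg := congrArg (fun K : H →L[ℂ] H => eigenProj T (t : ℂ) (K (eigenProj T (s : ℂ) x))) hγ
    change eigenProj T (t : ℂ) (L (eigenProj T (s : ℂ) x)) = eigenProj T (t : ℂ)
      (funCalc T sqrtInvAbsOne (γ (funCalc T sqrtInvAbsOne (eigenProj T (s : ℂ) x)))) at hg
    rw [hL, eigenProj_funCalc hT hCb, funCalc_eigenProj hT hd hCb, map_smul, map_smul] at hg
    rw [e, hqe, map_smul, eigenProj_eigenProj_zero hT, funCalc_eigenProj hT hd hAb, map_smul,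
      funCalc_eigenProj hT hd hφb, map_smul, map_smul, map_smul, map_smul, hX,
      eigenProj_funCalc hT hAb, map_smul, eigenProj_funCalc hT hφb, eigenProj_zero_eigenProj hT,
      map_smul, map_smul, hX, eigenProj_funCalc hT hBb, funCalc_eigenProj hT hd hBb, map_smul,
      map_smul]
    have key : ∀ u : ℝ, u ≠ 0 → |u|⁻¹ * φ u * u = regSign ε u - 1 := by
      intro u hu
      simp only [hφ]
      rcases lt_or_gt_of_ne hu with h | h
      · rw [abs_of_neg h, Real.sign_of_neg h]; field_simp
      · rw [abs_of_pos h, Real.sign_of_pos h]; field_simp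
    by_cases hs : s = 0
    · by_cases ht : t = 0
      · simp [hs, ht]
      · have k := key t ht
        simp only [hs, ht, if_true, if_false, phaseFun, smul_smul, abs_zero, inv_zero,
          Real.sqrt_zero, regSign_zero_right, Complex.ofReal_zero, zero_smul, zero_mul,
          smul_zero, zero_add, add_zero, sub_zero, Complex.ofReal_one, one_mul]
        congr 1
        rw [← k]
        push_cast
        ring
    · by_cases ht : t = 0
      · have k := key s hs
        simp only [hs, ht, if_true, if_false, phaseFun, smul_smul, abs_zero, inv_zero,
          Real.sqrt_zero, regSign_zero_right, Complex.ofReal_zero, zero_smul, zero_mul,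
          smul_zero, zero_add, add_zero, Complex.ofReal_one, one_mul]
        congr 1
        rw [show (1 : ℝ) - regSign ε s = -(regSign ε s - 1) by ring, ← k]
        push_cast
        ring
      · simp only [hs, ht, if_false, or_self, sqrtInvAbsOne] at hg
        rw [← hg]
        simp [hs, ht, phaseFun]
  · rw [norm_smul, Complex.norm_I, one_mul]
    calc ‖eigenProj T 0 * X * funCalc T φ‖ ≤ ‖eigenProj T 0‖ * ‖X‖ * ‖funCalc T φ‖ :=
          (norm_mul_le _ _).trans (by gcongr; exact norm_mul_le _ _)
      _ ≤ 1 * ‖X‖ * 2 := by gcongr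
      _ = 2 * ‖X‖ := by ring
  · rw [norm_smul, Complex.norm_I, one_mul]
    calc ‖funCalc T φ * X * eigenProj T 0‖ ≤ ‖funCalc T φ‖ * ‖X‖ * ‖eigenProj T 0‖ :=
          (norm_mul_le _ _).trans (by gcongr; exact norm_mul_le _ _)
      _ ≤ 2 * ‖X‖ * 1 := by gcongr
      _ = 2 * ‖X‖ := by ring

end NCG

/-! ### Singular values and the eigenvalues of |D| -/

namespace NCG

theorem self_mul_sign (s : ℝ) : s * Real.sign s = |s| := by
  rcases lt_trichotomy s 0 with h | rfl | h
  · rw [Real.sign_of_neg h, abs_of_neg h]; ring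
  · simp
  · rw [Real.sign_of_pos h, abs_of_pos h, mul_one]

theorem mem_opSpectrum_of_eigenspace_ne_bot {H : Type*} [NormedAddCommGroup H]
    [InnerProductSpace ℂ H] {T : H →ₗ.[ℂ] H} {z : ℂ} (h : eigenspace T z ≠ ⊥) :
    z ∈ opSpectrum T := by
  rintro ⟨R, -, hR⟩
  obtain ⟨x, hx, hx0⟩ := (Submodule.ne_bot_iff _).1 h
  obtain ⟨y, hy, rfl⟩ := mem_eigenspace_iff.1 hx
  apply hx0
  rw [← hR y, hy, sub_self, map_zero]

theorem IsEssentiallyDiscreteOp.finite_eigenvalues {H : Type*} [NormedAddCommGroup H]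
    [InnerProductSpace ℂ H] {T : H →ₗ.[ℂ] H} (hd : IsEssentiallyDiscreteOp T) (t : ℝ) :
    {s : ℝ | (0 < |s| ∧ |s| ≤ t) ∧ eigenspace T (s : ℂ) ≠ ⊥}.Finite := by
  refine ((hd.1 t).preimage Complex.ofReal_injective.injOn).subset ?_
  rintro s ⟨⟨h0, h1⟩, h2⟩
  exact ⟨⟨mem_opSpectrum_of_eigenspace_ne_bot h2, by simpa using abs_pos.1 h0⟩, by simpa using h1⟩

/-- The indicator function of `{s | 0 < |s| ≤ t}`. -/
def annulus (t s : ℝ) : ℝ := if 0 < |s| ∧ |s| ≤ t then 1 else 0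

section SingularValue

variable {H : Type*} [NormedAddCommGroup H] [InnerProductSpace ℂ H]

theorem singularValue_le {k : ℕ} {T R : H →L[ℂ] H}
    (hR : LinearMap.rank (R : H →ₗ[ℂ] H) ≤ k) : singularValue k T ≤ ‖T - R‖ :=
  csInf_le ⟨0, by rintro _ ⟨R, -, rfl⟩; exact norm_nonneg _⟩ ⟨R, hR, rfl⟩

theorem le_singularValue {k : ℕ} {T : H →L[ℂ] H} {c : ℝ}
    (h : ∀ R : H →L[ℂ] H, LinearMap.rank (R : H →ₗ[ℂ] H) ≤ k → c ≤ ‖T - R‖) :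
    c ≤ singularValue k T := by
  refine le_csInf ⟨‖T - 0‖, 0, ?_, rfl⟩ ?_
  · rw [ContinuousLinearMap.toLinearMap_zero, LinearMap.rank_zero]
    exact zero_le
  · rintro _ ⟨R, hR, rfl⟩
    exact h R hR

theorem rank_mul_le_left (S R : H →L[ℂ] H) :
    LinearMap.rank ((S * R : H →L[ℂ] H) : H →ₗ[ℂ] H) ≤ LinearMap.rank (S : H →ₗ[ℂ] H) :=
  LinearMap.rank_comp_le_left (R : H →ₗ[ℂ] H) (S : H →ₗ[ℂ] H)

theorem rank_mul_le_right (S R : H →L[ℂ] H) :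
    LinearMap.rank ((S * R : H →L[ℂ] H) : H →ₗ[ℂ] H) ≤ LinearMap.rank (R : H →ₗ[ℂ] H) :=
  LinearMap.rank_comp_le_right (R : H →ₗ[ℂ] H) (S : H →ₗ[ℂ] H)

theorem rank_clm_add_le (S R : H →L[ℂ] H) :
    LinearMap.rank ((S + R : H →L[ℂ] H) : H →ₗ[ℂ] H) ≤
      LinearMap.rank (S : H →ₗ[ℂ] H) + LinearMap.rank (R : H →ₗ[ℂ] H) :=
  LinearMap.rank_add_le (S : H →ₗ[ℂ] H) (R : H →ₗ[ℂ] H)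

theorem singularValue_mul_le {J : H →L[ℂ] H} (hJ : ‖J‖ ≤ 1) (k : ℕ) (T : H →L[ℂ] H) :
    singularValue k (J * T) ≤ singularValue k T := by
  refine le_singularValue fun R hR => ?_
  refine (singularValue_le ((rank_mul_le_right J R).trans hR)).trans ?_
  rw [← mul_sub]
  exact (norm_mul_le _ _).trans (mul_le_of_le_one_left (norm_nonneg _) hJ)

theorem singularValue_four_mul_le {α β γ A B Q : H →L[ℂ] H} {k : ℕ} {c : ℝ} (hc : 0 ≤ c)
    (hQ : LinearMap.rank (Q : H →ₗ[ℂ] H) ≤ k)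
    (hAr : ‖A - A * Q‖ ≤ c) (hAl : ‖A - Q * A‖ ≤ c)
    (hBr : ‖B - B * Q‖ ≤ √c) (hBl : ‖B - Q * B‖ ≤ √c) :
    singularValue (4 * k) (α * A + A * β + B * γ * B) ≤ (‖α‖ + ‖β‖ + ‖γ‖) * c := by
  -- Four summands, each containing Q as a factor, hence the index 4k. The γ-term is cut on both
  -- sides, so its error carries √c twice.
  set R := α * A * Q + Q * (A * β) + (Q * (B * γ * B) + (B - Q * B) * γ * B * Q) with hR
  have hrank : LinearMap.rank (R : H →ₗ[ℂ] H) ≤ ((4 * k : ℕ) : Cardinal) := by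
    have h1 := (rank_mul_le_right (α * A) Q).trans hQ
    have h2 := (rank_mul_le_left Q (A * β)).trans hQ
    have h3 := (rank_mul_le_left Q (B * γ * B)).trans hQ
    have h4 := (rank_mul_le_right ((B - Q * B) * γ * B) Q).trans hQ
    have e : ((4 * k : ℕ) : Cardinal) = (k + k) + (k + k) := by
      rw [← Nat.cast_add, ← Nat.cast_add]
      congr 1
      ring
    rw [e]
    exact (rank_clm_add_le _ _).trans (add_le_add ((rank_clm_add_le _ _).trans (add_le_add h1 h2))
      ((rank_clm_add_le _ _).trans (add_le_add h3 h4)))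
  refine (singularValue_le hrank).trans ?_
  have e : α * A + A * β + B * γ * B - R =
      α * (A - A * Q) + (A - Q * A) * β + (B - Q * B) * γ * (B - B * Q) := by
    rw [hR]; noncomm_ring
  rw [e]
  calc _ ≤ ‖α‖ * ‖A - A * Q‖ + ‖A - Q * A‖ * ‖β‖ + ‖B - Q * B‖ * ‖γ‖ * ‖B - B * Q‖ := by
        refine (norm_add₃_le).trans ?_
        gcongr
        · exact norm_mul_le _ _
        · exact norm_mul_le _ _
        · exact (norm_mul_le _ _).trans (by gcongr; exact norm_mul_le _ _)
    _ ≤ ‖α‖ * c + c * ‖β‖ + √c * ‖γ‖ * √c := by gcongr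
    _ = _ := by
        have := Real.mul_self_sqrt hc
        linear_combination ‖γ‖ * this

theorem exists_mem_ne_zero_of_rank {k : ℕ} {W : Submodule ℂ H} {R : H →ₗ[ℂ] H}
    (hR : LinearMap.rank R ≤ k) (hW : ((k + 1 : ℕ) : Cardinal) ≤ Module.rank ℂ W) :
    ∃ x ∈ W, x ≠ 0 ∧ R x = 0 := by
  by_contra! h
  have hinj : Function.Injective (R.rangeRestrict.comp W.subtype) := by
    rw [injective_iff_map_eq_zero]
    intro x hx
    by_contra hx0
    exact h x x.2 (by simpa using hx0) (by simpa [Subtype.ext_iff] using hx)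
  have h1 := (hW.trans (LinearMap.rank_le_of_injective _ hinj)).trans hR
  rw [Nat.cast_le] at h1
  omega

theorem isBoundedOnEigenvalues_annulus (T : H →ₗ.[ℂ] H) (t : ℝ) :
    IsBoundedOnEigenvalues T (annulus t) :=
  ⟨1, fun s _ => by rw [annulus]; split_ifs <;> simp⟩

theorem isBoundedOnEigenvalues_sign (T : H →ₗ.[ℂ] H) : IsBoundedOnEigenvalues T Real.sign :=
  ⟨1, fun s _ => by rcases Real.sign_apply_eq s with h | h | h <;> simp [h]⟩

end SingularValue

/-- Let t increase to Λ, or to infinity when Λ = ∞; in the latter case the bound becomes 0. This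
allows the truncation at t < λ_{k+1}, where the spectral projection has rank at most k. -/
theorem le_mul_toReal_inv {Λ : ℝ≥0∞} (h0 : 0 < Λ) {v K : ℝ}
    (h : ∀ t : ℝ≥0, 0 < t → (t : ℝ≥0∞) < Λ → v ≤ K * (t : ℝ)⁻¹) : v ≤ K * Λ⁻¹.toReal := by
  induction Λ with
  | top =>
    have hlim : Filter.Tendsto (fun t : ℝ≥0 => K * (t : ℝ)⁻¹) Filter.atTop (nhds (K * 0)) :=
      (tendsto_inv_atTop_zero.comp (NNReal.tendsto_coe_atTop.2 Filter.tendsto_id)).const_mul K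
    simp only [ENNReal.inv_top, ENNReal.toReal_zero]
    refine ge_of_tendsto hlim ?_
    filter_upwards [Filter.eventually_gt_atTop 0] with t ht
    exact h t ht ENNReal.coe_lt_top
  | coe Λ =>
    have hΛ : 0 < Λ := by exact_mod_cast h0
    have hlim : Filter.Tendsto (fun t : ℝ≥0 => K * (t : ℝ)⁻¹) (nhdsWithin Λ (Set.Iio Λ))
        (nhds (K * (Λ : ℝ)⁻¹)) := by
      refine Filter.Tendsto.mono_left ?_ nhdsWithin_le_nhds
      exact ((NNReal.continuous_coe.tendsto Λ).inv₀ (by exact_mod_cast hΛ.ne')).const_mul K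
    rw [ENNReal.toReal_inv, ENNReal.coe_toReal]
    have : (nhdsWithin Λ (Set.Iio Λ)).NeBot := nhdsLT_neBot_of_exists_lt ⟨0, hΛ⟩
    refine ge_of_tendsto hlim ?_
    filter_upwards [self_mem_nhdsWithin, nhdsWithin_le_nhds (lt_mem_nhds hΛ)] with t ht ht0
    exact h t ht0 (by exact_mod_cast ht)

variable {H : Type*} [NormedAddCommGroup H] [InnerProductSpace ℂ H] [CompleteSpace H]

section Truncation

variable {T : H →ₗ.[ℂ] H} (hT : IsSelfAdjoint T) (hd : IsEssentiallyDiscreteOp T)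

include hT hd

/-- The cut-off removes the values of f on 0 < |s| ≤ t. It does not touch the kernel, which is why f
0 = 0 is required. -/
theorem norm_sub_mul_annulus_le {f : ℝ → ℝ} (hf : IsBoundedOnEigenvalues T f) {t c : ℝ}
    (h0 : f 0 = 0) (hc : 0 ≤ c) (h : ∀ s, t < |s| → |f s| ≤ c) :
    ‖funCalc T f - funCalc T f * funCalc T (annulus t)‖ ≤ c ∧
      ‖funCalc T f - funCalc T (annulus t) * funCalc T f‖ ≤ c := by
  have hq := isBoundedOnEigenvalues_annulus T t
  have key : ∀ s : ℝ, |f s - f s * annulus t s| ≤ c := by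
    intro s
    rw [annulus]
    split_ifs with hs
    · simpa using hc
    · rw [mul_zero, sub_zero]
      by_cases hs0 : s = 0
      · rw [hs0, h0, abs_zero]; exact hc
      · exact h s (not_le.1 fun h' => hs ⟨abs_pos.2 hs0, h'⟩)
  constructor
  · refine ContinuousLinearMap.opNorm_le_bound _ hc fun x => ?_
    refine norm_le_of_forall_eigenProj hT hd hc fun s => ?_
    change ‖eigenProj T (s : ℂ) (funCalc T f x - funCalc T f (funCalc T (annulus t) x))‖ ≤ _
    rw [map_sub, eigenProj_funCalc hT hf, eigenProj_funCalc hT hf, eigenProj_funCalc hT hq,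
      smul_smul, ← sub_smul, norm_smul, ← Complex.ofReal_mul, ← Complex.ofReal_sub,
      Complex.norm_real, Real.norm_eq_abs]
    gcongr
    exact key s
  · refine ContinuousLinearMap.opNorm_le_bound _ hc fun x => ?_
    refine norm_le_of_forall_eigenProj hT hd hc fun s => ?_
    change ‖eigenProj T (s : ℂ) (funCalc T f x - funCalc T (annulus t) (funCalc T f x))‖ ≤ _
    rw [map_sub, eigenProj_funCalc hT hq, eigenProj_funCalc hT hf,
      smul_smul, ← sub_smul, norm_smul, ← Complex.ofReal_mul, ← Complex.ofReal_sub,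
      Complex.norm_real, Real.norm_eq_abs, mul_comm (annulus t s)]
    gcongr
    exact key s

/-- An operator of rank at most k kills a nonzero vector of the space W of dimension at least k + 1,
and |T|⁻¹ is bounded below by t⁻¹ on W. -/
theorem inv_le_norm_sub_of_rank {W : Submodule ℂ H} {t : ℝ} (ht : 0 < t)
    (hW : ∀ x ∈ W, ∀ s : ℝ, ¬ (0 < |s| ∧ |s| ≤ t) → eigenProj T (s : ℂ) x = 0) {k : ℕ}
    (hk : ((k + 1 : ℕ) : Cardinal) ≤ Module.rank ℂ W) {R : H →L[ℂ] H}
    (hR : LinearMap.rank (R : H →ₗ[ℂ] H) ≤ k) :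
    t⁻¹ ≤ ‖funCalc T (fun x => |x|⁻¹) - R‖ := by
  obtain ⟨x, hxW, hx0, hRx⟩ := exists_mem_ne_zero_of_rank hR hk
  have h1 : ‖x‖ ≤ t * ‖funCalc T (fun x => |x|⁻¹) x‖ := by
    refine norm_le_of_forall_eigenProj hT hd ht.le fun s => ?_
    rw [eigenProj_funCalc hT (isBoundedOnEigenvalues_inv_abs hd), norm_smul, Complex.norm_real,
      Real.norm_eq_abs, abs_inv, abs_abs]
    by_cases hs : 0 < |s| ∧ |s| ≤ t
    · rw [← mul_assoc]
      refine le_mul_of_one_le_left (norm_nonneg _) ?_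
      rw [← div_eq_mul_inv, one_le_div hs.1]
      exact hs.2
    · rw [hW x hxW s hs]
      simp
  have h2 := (funCalc T (fun x => |x|⁻¹) - R).le_opNorm x
  have h3 : (funCalc T (fun x => |x|⁻¹) - R) x = funCalc T (fun x => |x|⁻¹) x := by
    have : R x = 0 := hRx
    rw [sub_apply, this, sub_zero]
  rw [h3] at h2
  rw [inv_le_iff_one_le_mul₀' ht]
  refine le_of_mul_le_mul_right ?_ (norm_pos_iff.2 hx0)
  rw [one_mul, mul_assoc]
  exact h1.trans (by gcongr)

end Truncation

namespace SpectralTriple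

variable (S : SpectralTriple H) (hS : S.IsEssentiallyDiscrete)

include hS in
theorem norm_signD_le : ‖S.signD‖ ≤ 1 :=
  norm_funCalc_le S.selfAdjoint hS zero_le_one fun s _ => by
    rcases Real.sign_apply_eq s with h | h | h <;> simp [h]

/-- The span of the eigenspaces of `|D|` for the eigenvalues in `(0, t]`. -/
def absSpan (t : ℝ) : Submodule ℂ H := ⨆ s ∈ Set.Ioc (0 : ℝ) t, eigenspace S.absD (s : ℂ)

/-- Applying the eigenprojection at u to |D| y = s y gives (|u| - s) P_u y = 0. -/
theorem eigenProj_of_mem_absSpan {t : ℝ} {x : H} (hx : x ∈ S.absSpan t) (u : ℝ)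
    (hu : ¬ (0 < |u| ∧ |u| ≤ t)) : eigenProj S.D (u : ℂ) x = 0 := by
  have h : S.absSpan t ≤ LinearMap.ker (eigenProj S.D (u : ℂ) : H →ₗ[ℂ] H) := by
    refine iSup₂_le fun s hs x hx => ?_
    obtain ⟨y, hy, rfl⟩ := mem_eigenspace_iff.1 hx
    obtain ⟨y, hyD⟩ := y
    change S.signD (S.D ⟨y, hyD⟩) = (s : ℂ) • y at hy
    change eigenProj S.D (u : ℂ) y = 0
    have h1 := congrArg (eigenProj S.D (u : ℂ)) hy
    rw [signD, eigenProj_funCalc S.selfAdjoint (isBoundedOnEigenvalues_sign _),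
      eigenProj_map S.selfAdjoint, map_smul, smul_smul, ← Complex.ofReal_mul, mul_comm,
      self_mul_sign, ← sub_eq_zero, ← sub_smul, ← Complex.ofReal_sub, smul_eq_zero] at h1
    refine h1.resolve_left ?_
    rw [Complex.ofReal_eq_zero, sub_eq_zero]
    intro h2
    exact hu (h2 ▸ hs)
  exact h hx

theorem mem_eigenspace_absD {u : ℝ} {x : H} (hS : S.IsEssentiallyDiscrete)
    (hx : x ∈ eigenspace S.D (u : ℂ)) : x ∈ eigenspace S.absD ((|u| : ℝ) : ℂ) := by
  have hx' := hx
  obtain ⟨y, hy, rfl⟩ := mem_eigenspace_iff.1 hx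
  refine mem_eigenspace_iff.2 ⟨y, ?_, rfl⟩
  change S.signD (S.D y) = _
  rw [hy, map_smul, ← eigenProj_eq_self hx', signD,
    funCalc_eigenProj S.selfAdjoint hS (isBoundedOnEigenvalues_sign _), smul_smul,
    ← Complex.ofReal_mul, self_mul_sign]

include hS

/-- Only finitely many eigenvalues satisfy 0 < |s| ≤ t, so the expansion of x is a finite sum and x
lies in the algebraic span, without closure. -/
theorem mem_absSpan {t : ℝ} {x : H}
    (h : ∀ u : ℝ, ¬ (0 < |u| ∧ |u| ≤ t) → eigenProj S.D (u : ℂ) x = 0) : x ∈ S.absSpan t := by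
  have hfin := IsEssentiallyDiscreteOp.finite_eigenvalues hS t
  have h1 : HasSum (fun s : ℝ => eigenProj S.D (s : ℂ) x)
      (∑ s ∈ hfin.toFinset, eigenProj S.D (s : ℂ) x) := by
    refine hasSum_sum_of_ne_finset_zero fun s hs => ?_
    by_cases hs1 : 0 < |s| ∧ |s| ≤ t
    · have hb : eigenspace S.D (s : ℂ) = ⊥ := by
        by_contra hb
        exact hs (hfin.mem_toFinset.2 ⟨hs1, hb⟩)
      have := eigenProj_mem S.selfAdjoint (s : ℂ) x
      rwa [hb, Submodule.mem_bot] at this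
    · exact h s hs1
  rw [(hasSum_eigenProj S.selfAdjoint hS x).unique h1]
  refine Submodule.sum_mem _ fun s hs => ?_
  have hs1 := (hfin.mem_toFinset.1 hs).1
  exact Submodule.mem_iSup_of_mem |s| (Submodule.mem_iSup_of_mem hs1
    (S.mem_eigenspace_absD hS (eigenProj_mem S.selfAdjoint _ _)))

theorem rank_annulus_le {t : ℝ≥0} (ht : 0 < t) {k : ℕ}
    (h : (t : ℝ≥0∞) < posEigenvalue S.absD (k + 1)) :
    LinearMap.rank (funCalc S.D (annulus t) : H →ₗ[ℂ] H) ≤ k := by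
  have h1 : LinearMap.rank (funCalc S.D (annulus t) : H →ₗ[ℂ] H) ≤
      Module.rank ℂ (S.absSpan t) := by
    refine Submodule.rank_mono ?_
    rintro _ ⟨x, rfl⟩
    refine S.mem_absSpan hS fun u hu => ?_
    change eigenProj S.D (u : ℂ) (funCalc S.D (annulus t) x) = 0
    rw [eigenProj_funCalc S.selfAdjoint (isBoundedOnEigenvalues_annulus _ _), annulus, if_neg hu]
    simp
  refine h1.trans ?_
  by_contra h2
  rw [not_le] at h2
  have h3 : ((k + 1 : ℕ) : Cardinal) ≤ Module.rank ℂ (S.absSpan t) := by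
    rw [Nat.cast_add, Nat.cast_one]
    exact Cardinal.add_one_le_of_lt h2
  exact absurd h (not_lt.2 (iInf₂_le t ⟨ht, h3⟩))

/-- Eigenvalues do not accumulate at 0: |u|⁻¹ ≤ C on nonzero eigenvalues, so below (max C 0 + 1)⁻¹
the span is zero and cannot have dimension k + 1. -/
theorem posEigenvalue_pos (k : ℕ) : 0 < posEigenvalue S.absD (k + 1) := by
  obtain ⟨C, hC⟩ := isBoundedOnEigenvalues_inv_abs hS
  set c : ℝ≥0 := (C.toNNReal + 1)⁻¹ with hc
  have hc0 : 0 < c := by positivity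
  refine lt_of_lt_of_le (b := (c : ℝ≥0∞)) (by exact_mod_cast hc0) ?_
  refine le_iInf₂ fun t ⟨ht0, ht⟩ => ?_
  by_contra hlt
  rw [not_le, ENNReal.coe_lt_coe] at hlt
  have h0 : S.absSpan t = ⊥ := by
    rw [Submodule.eq_bot_iff]
    intro x hx
    refine ext_eigenProj S.selfAdjoint hS fun u => ?_
    rw [map_zero]
    by_cases hu : 0 < |u| ∧ |u| ≤ t
    · by_contra h1
      have hb : eigenspace S.D (u : ℂ) ≠ ⊥ := fun hb => h1 (by
        have := eigenProj_mem S.selfAdjoint (u : ℂ) x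
        rwa [hb, Submodule.mem_bot] at this)
      have h2 := hC u hb
      rw [abs_inv, abs_abs] at h2
      have h3 : |u| < (c : ℝ) := hu.2.trans_lt (by exact_mod_cast hlt)
      have h4 : (c : ℝ)⁻¹ < |u|⁻¹ := inv_strictAnti₀ hu.1 h3
      have h5 : (c : ℝ)⁻¹ = max C 0 + 1 := by rw [hc]; simp
      rw [h5] at h4
      linarith [le_max_left C 0]
    · exact S.eigenProj_of_mem_absSpan hx u hu
  change _ ≤ Module.rank ℂ (S.absSpan t) at ht
  rw [h0, rank_bot] at ht
  simp at ht

theorem norm_inv_sub_annulus_le {t : ℝ} (ht : 0 < t) :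
    (‖S.invAbsD - S.invAbsD * funCalc S.D (annulus t)‖ ≤ t⁻¹ ∧
      ‖S.invAbsD - funCalc S.D (annulus t) * S.invAbsD‖ ≤ t⁻¹) ∧
    (‖S.invSqrtAbsD - S.invSqrtAbsD * funCalc S.D (annulus t)‖ ≤ √t⁻¹ ∧
      ‖S.invSqrtAbsD - funCalc S.D (annulus t) * S.invSqrtAbsD‖ ≤ √t⁻¹) := by
  refine ⟨norm_sub_mul_annulus_le S.selfAdjoint hS (isBoundedOnEigenvalues_inv_abs hS) (by simp)
    (by positivity) fun s hs => ?_, norm_sub_mul_annulus_le S.selfAdjoint hS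
    (isBoundedOnEigenvalues_sqrt_inv_abs hS) (by simp) (by positivity) fun s hs => ?_⟩
  · rw [abs_inv, abs_abs]
    gcongr
  · rw [abs_of_nonneg (Real.sqrt_nonneg _)]
    gcongr

/-- Truncation below λ_{k+1} gives the upper bound. For the lower bound, each t admitted in the
infimum defining λ_{k+1} has a spectral span of dimension at least k + 1. -/
theorem singularValue_invAbsD (k : ℕ) :
    singularValue k S.invAbsD = ((posEigenvalue S.absD (k + 1))⁻¹).toReal := by
  refine le_antisymm ?_ ?_
  · rw [← one_mul ((posEigenvalue S.absD (k + 1))⁻¹).toReal]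
    refine le_mul_toReal_inv (S.posEigenvalue_pos hS k) fun t ht0 ht => ?_
    rw [one_mul]
    exact (singularValue_le ((rank_mul_le_right _ _).trans (S.rank_annulus_le hS ht0 ht))).trans
      (S.norm_inv_sub_annulus_le hS (by exact_mod_cast ht0)).1.1
  · refine le_singularValue fun R hR => ?_
    refine ENNReal.toReal_le_of_le_ofReal (norm_nonneg _) ?_
    rw [ENNReal.inv_le_iff_inv_le]
    refine le_iInf₂ fun t ⟨ht0, ht⟩ => ?_
    rw [ENNReal.inv_le_iff_inv_le]
    have ht0' : (0 : ℝ) < t := by exact_mod_cast ht0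
    have h := inv_le_norm_sub_of_rank S.selfAdjoint hS ht0'
      (fun x hx => S.eigenProj_of_mem_absSpan hx) ht hR
    rw [← ENNReal.ofReal_coe_nnreal, ← ENNReal.ofReal_inv_of_pos ht0']
    exact ENNReal.ofReal_le_ofReal h

/-- D⁻¹ and |D|⁻¹ arise from each other by multiplication with the contraction sign(D), which gives
both inequalities. -/
theorem singularValue_invD (k : ℕ) : singularValue k S.invD = singularValue k S.invAbsD := by
  have hA := isBoundedOnEigenvalues_inv_abs hS
  have hD : IsBoundedOnEigenvalues S.D fun s => s⁻¹ :=
    hS.exists_bound fun s hs => by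
      rw [abs_inv]
      exact inv_le_one_of_one_le₀ hs.le
  have hs := isBoundedOnEigenvalues_sign S.D
  have h1 : S.invD = S.signD * S.invAbsD := by
    ext x
    refine ext_eigenProj S.selfAdjoint hS fun s => ?_
    change eigenProj S.D (s : ℂ) (funCalc S.D (fun s => s⁻¹) x) = eigenProj S.D (s : ℂ)
      (funCalc S.D Real.sign (funCalc S.D (fun s => |s|⁻¹) x))
    rw [eigenProj_funCalc S.selfAdjoint hD, eigenProj_funCalc S.selfAdjoint hs,
      eigenProj_funCalc S.selfAdjoint hA, smul_smul, ← Complex.ofReal_mul]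
    congr 2
    rcases lt_trichotomy s 0 with h | rfl | h
    · rw [Real.sign_of_neg h, abs_of_neg h, inv_neg]; ring
    · simp
    · rw [Real.sign_of_pos h, abs_of_pos h, one_mul]
  have h2 : S.invAbsD = S.signD * S.invD := by
    ext x
    refine ext_eigenProj S.selfAdjoint hS fun s => ?_
    change eigenProj S.D (s : ℂ) (funCalc S.D (fun s => |s|⁻¹) x) = eigenProj S.D (s : ℂ)
      (funCalc S.D Real.sign (funCalc S.D (fun s => s⁻¹) x))
    rw [eigenProj_funCalc S.selfAdjoint hA, eigenProj_funCalc S.selfAdjoint hs,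
      eigenProj_funCalc S.selfAdjoint hD, smul_smul, ← Complex.ofReal_mul]
    congr 2
    rcases lt_trichotomy s 0 with h | rfl | h
    · rw [Real.sign_of_neg h, abs_of_neg h, inv_neg]; ring
    · simp
    · rw [Real.sign_of_pos h, abs_of_pos h, one_mul]
  refine le_antisymm ?_ ?_
  · rw [h1]
    exact singularValue_mul_le (S.norm_signD_le hS) k _
  · nth_rewrite 1 [h2]
    exact singularValue_mul_le (S.norm_signD_le hS) k _

theorem singularValue_four_mul_le_of_eq {α β γ q : H →L[ℂ] H} {M : ℝ}
    (hq : q = α * S.invAbsD + S.invAbsD * β + S.invSqrtAbsD * γ * S.invSqrtAbsD)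
    (hα : ‖α‖ ≤ 2 * M) (hβ : ‖β‖ ≤ 2 * M) (hγ : ‖γ‖ ≤ M) (k : ℕ) :
    singularValue (4 * k) q ≤ 5 * M * singularValue k S.invAbsD := by
  rw [S.singularValue_invAbsD hS]
  refine le_mul_toReal_inv (S.posEigenvalue_pos hS k) fun t ht0 ht => ?_
  have ht0' : (0 : ℝ) < t := by exact_mod_cast ht0
  have hb := S.norm_inv_sub_annulus_le hS ht0'
  rw [hq]
  refine (singularValue_four_mul_le (inv_nonneg.2 ht0'.le) (S.rank_annulus_le hS ht0 ht)
    hb.1.1 hb.1.2 hb.2.1 hb.2.2).trans ?_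
  gcongr
  linarith

-- Eigenvectors lie in dom D, so the bounded extension can be evaluated there. This block formula is
-- what the estimates use about [D, a], besides its norm.
omit hS in
theorem eigenProj_commutator (a : S.A) (s t : ℝ) (x : H) :
    eigenProj S.D (t : ℂ) (S.commutator a (eigenProj S.D (s : ℂ) x)) =
      ((t - s : ℝ) : ℂ) • eigenProj S.D (t : ℂ) ((a : H →L[ℂ] H) (eigenProj S.D (s : ℂ) x)) := by
  obtain ⟨y, hy, hyx⟩ := mem_eigenspace_iff.1 (eigenProj_mem S.selfAdjoint (s : ℂ) x)
  rw [← hyx, S.commutator_apply]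
  change eigenProj S.D (t : ℂ) (S.D ⟨(a : H →L[ℂ] H) y, S.map_domain a a.2 y y.2⟩ -
    (a : H →L[ℂ] H) (S.D y)) = _
  rw [map_sub, eigenProj_map S.selfAdjoint, hy, map_smul, map_smul, ← sub_smul,
    ← Complex.ofReal_sub]

end SpectralTriple

end NCG

end

theorem mainTheorem1 {H : Type*} [NormedAddCommGroup H] [InnerProductSpace ℂ H] [CompleteSpace H]
    (S : NCG.SpectralTriple H) (hS : S.IsEssentiallyDiscrete)
    (a : S.A) (ha : IsSelfAdjoint (a : H →L[ℂ] H)) :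
    (∃ α β γ : H →L[ℂ] H,
      NCG.quantumDiff S.F a =
          α * S.invAbsD + S.invAbsD * β + S.invSqrtAbsD * γ * S.invSqrtAbsD ∧
        ‖α‖ ≤ 2 * ‖S.commutator a‖ ∧ ‖β‖ ≤ 2 * ‖S.commutator a‖ ∧ ‖γ‖ ≤ ‖S.commutator a‖) ∧
    (∃ α β γ : H →L[ℂ] H,
      NCG.quantumDiff S.F₀ a =
          α * S.invAbsD + S.invAbsD * β + S.invSqrtAbsD * γ * S.invSqrtAbsD ∧
        ‖α‖ ≤ 2 * ‖S.commutator a‖ ∧ ‖β‖ ≤ 2 * ‖S.commutator a‖ ∧ ‖γ‖ ≤ ‖S.commutator a‖) ∧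
    ∀ k : ℕ,
      NCG.singularValue (4 * k) (NCG.quantumDiff S.F₀ a) ≤
          5 * ‖S.commutator a‖ * NCG.singularValue k S.invAbsD ∧
        NCG.singularValue (4 * k) (NCG.quantumDiff S.F a) ≤
          5 * ‖S.commutator a‖ * NCG.singularValue k S.invAbsD ∧
        NCG.singularValue k S.invD = NCG.singularValue k S.invAbsD ∧
        NCG.singularValue k S.invAbsD = ((NCG.posEigenvalue S.absD (k + 1))⁻¹).toReal := by
  -- The parameter ε = 1 gives F, and ε = 0 gives F₀ because `regSign 0` is the sign function.
  have h1 := NCG.exists_quantumDiff_eq S.selfAdjoint hS (S.eigenProj_commutator a)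
    (zero_le_one' ℝ)
  have h0 := NCG.exists_quantumDiff_eq S.selfAdjoint hS (S.eigenProj_commutator a)
    (le_refl (0 : ℝ))
  rw [NCG.regSign_zero_left] at h0
  refine ⟨h1, h0, fun k => ?_⟩
  obtain ⟨_, _, _, e1, b1, c1, d1⟩ := h1
  obtain ⟨_, _, _, e0, b0, c0, d0⟩ := h0
  exact ⟨S.singularValue_four_mul_le_of_eq hS e0 b0 c0 d0 k,
    S.singularValue_four_mul_le_of_eq hS e1 b1 c1 d1 k, S.singularValue_invD hS k,
    S.singularValue_invAbsD hS k⟩
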